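/- For a permutation $\pi=\pi_1\pi_2\cdots\pi_n$ of $\{1,\dots,n\}$ let $\ell(\pi)$ be its length, i.e. the minimal $k$ such that $\pi=s_{i_1}\cdots s_{i_k}$ with $s_i=(i\;\,i+1)$, $1\le i\le n-1$; the words $i_1\cdots i_k$ of this minimal length are the reduced words of $\pi$, and $R(\pi)$ is the set of them. A commutation move switches two adjacent letters $j,k$ with $|j-k|>1$; a long braid move exchanges consecutive letters $j(j+1)j$ and $(j+1)j(j+1)$. Let $G_\pi$ be the graph on $R(\pi)$ whose edges are the commutation moves and the long braid moves, let $C_\pi$ be $G_\pi$ contracted along the commutation edges (its vertices are the commutation classes, its edges come from long braid moves), and let $B_\pi$ be $G_\pi$ contracted along the long braid edges. For permutations $\sigma$ of $\{1,\dots,k\}$ and $\pi_{(1)},\dots,\pi_{(k)}$ of any sizes $\ge 0$, the inflation $\sigma[\pi_{(1)},\dots,\pi_{(k)}]$ is $\sigma$ with each letter $\sigma_i$ replaced by a block of consecutive positions, with consecutive values, order isomorphic to $\pi_{(i)}$. A permutation avoids $231$ if it has no subsequence order isomorphic to $231$. **Theorem.** Let $n\ge 1$, let $\pi$ be a $231$-avoiding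 permutation of $\{1,\dots,n\}$, and let $m$ be the position with $\pi_m=n$. Then $\pi=12[\pi',21[1,\pi'']]$ for some $231$-avoiding permutations $\pi'$ of size $m-1$ and $\pi''$ of size $n-m$. Moreover, for every such decomposition of $\pi$, with $\pi'$ of size $m-1$ and $\pi''$ of size $n-m$, the graphs $G_\pi$, $C_\pi$, $B_\pi$ are connected and 1. $\operatorname{diam}(G_\pi)=\operatorname{diam}(G_{\pi'})+\operatorname{diam}(G_{\pi''})+(n-m)\bigl(\ell(\pi')+\ell(\pi'')\bigr)+\ell(\pi'')\bigl(\ell(\pi')-1\bigr)$; 2. $\operatorname{diam}(C_\pi)=\operatorname{diam}(C_{\pi'})+\operatorname{diam}(C_{\pi''})+\ell(\pi'')$; 3. $\operatorname{diam}(B_\pi)=\operatorname{diam}(B_{\pi'})+\operatorname{diam}(B_{\pi''})+(n-m)\bigl(\ell(\pi')+\ell(\pi'')\bigr)+\ell(\pi'')\bigl(\ell(\pi')-2\bigr)$. -/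

import Mathlib

/-! Permutations of `{0, …, n - 1}` are Mathlib's `Equiv.Perm (Fin n)`; the one-line notation of `π`
is `π 0, π 1, …, π (n - 1)`. Positions, values and letters of words are therefore numbered from
`0` instead of `1`. -/

namespace PermGraph

/-! ### Patterns -/

/-- `π` contains the pattern `σ`: some subsequence of the one-line notation of `π` is order
isomorphic to that of `σ`. -/
def Contains {n k : ℕ} (π : Equiv.Perm (Fin n)) (σ : Equiv.Perm (Fin k)) : Prop :=
  ∃ f : Fin k ↪o Fin n, ∀ i j : Fin k, π (f i) ≤ π (f j) ↔ σ i ≤ σ j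

/-- `π` avoids the pattern `σ`. -/
def Avoids {n k : ℕ} (π : Equiv.Perm (Fin n)) (σ : Equiv.Perm (Fin k)) : Prop :=
  ¬ Contains π σ

/-- The permutation `231` of three letters. -/
def perm231 : Equiv.Perm (Fin 3) where
  toFun := ![1, 2, 0]
  invFun := ![2, 0, 1]
  left_inv := by decide
  right_inv := by decide

/-! ### Inflations -/

/-- Permutations of arbitrary finite size, including the empty permutation; `p.1` is the size. -/
abbrev SizedPerm : Type := Σ n : ℕ, Equiv.Perm (Fin n)

/-- The inflation `σ[p 0, …, p (k - 1)]`: every letter `σ i` of `σ` is replaced by a block that is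
order isomorphic to `p i`. A position of the inflation is a pair (block `i`, position `j` in
the block), and such pairs are arranged lexicographically; the value there is the pair
(`σ i`, `p i j`), and the pairs (value of `σ`, value in the block) are again arranged
lexicographically. -/
def inflation {k : ℕ} (σ : Equiv.Perm (Fin k)) (p : Fin k → SizedPerm) :
    SizedPerm :=
  ⟨∑ i, (p i).1,
    (finSigmaFinEquiv (n := fun i => (p i).1)).symm.trans <|
      (Equiv.sigmaCongrRight fun i => (p i).2).trans <|
        (Equiv.sigmaCongrLeft' (β := fun i => Fin (p i).1) σ).trans <|
          (finSigmaFinEquiv (n := fun c => (p (σ.symm c)).1)).trans <|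
            finCongr (Equiv.sum_comp σ.symm fun i => (p i).1)⟩

/-- The permutation `12`. -/
def perm12 : Equiv.Perm (Fin 2) := 1

/-- The permutation `21`. -/
def perm21 : Equiv.Perm (Fin 2) := Equiv.swap 0 1

/-- The permutation `1` of a single letter, as a permutation with a size. -/
def single : SizedPerm := ⟨1, 1⟩

/-! ### Reduced words -/

/-- The simple reflection that interchanges `i` and `i + 1` (only used for `i + 1 < n`). -/
def simpleReflection (n i : ℕ) : Equiv.Perm (Fin n) :=
  if h : i + 1 < n then Equiv.swap ⟨i, Nat.lt_of_succ_lt h⟩ ⟨i + 1, h⟩ else 1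

/-- `w` is a word for `π`: its letters are indices of simple reflections, and the product of
these reflections, in the order of the word, is `π`. -/
def IsWord {n : ℕ} (π : Equiv.Perm (Fin n)) (w : List ℕ) : Prop :=
  (∀ i ∈ w, i + 1 < n) ∧ (w.map (simpleReflection n)).prod = π

/-- `w` is a reduced word for `π`: a word for `π` of minimal length. -/
def IsReducedWord {n : ℕ} (π : Equiv.Perm (Fin n)) (w : List ℕ) : Prop :=
  IsWord π w ∧ ∀ v, IsWord π v → w.length ≤ v.length

/-- The set `R(π)` of reduced words of `π`, as a type. -/
abbrev ReducedWord {n : ℕ} (π : Equiv.Perm (Fin n)) : Type :=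
  {w : List ℕ // IsReducedWord π w}

/-- The length `ℓ(π)`: the minimal length of a word for `π`. -/
noncomputable def length {n : ℕ} (π : Equiv.Perm (Fin n)) : ℕ :=
  sInf {k | ∃ w, IsWord π w ∧ w.length = k}

/-! ### Moves and graphs -/

/-- A commutation move: two adjacent letters `j`, `k` with `|j - k| > 1` are switched. -/
def CommutationMove (u v : List ℕ) : Prop :=
  ∃ (x y : List ℕ) (j k : ℕ), (j + 1 < k ∨ k + 1 < j) ∧
    u = x ++ [j, k] ++ y ∧ v = x ++ [k, j] ++ y

/-- A long braid move: consecutive letters `j (j+1) j` and `(j+1) j (j+1)` are exchanged. -/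
def LongBraidMove (u v : List ℕ) : Prop :=
  ∃ (x y : List ℕ) (j : ℕ),
    (u = x ++ [j, j + 1, j] ++ y ∧ v = x ++ [j + 1, j, j + 1] ++ y) ∨
    (u = x ++ [j + 1, j, j + 1] ++ y ∧ v = x ++ [j, j + 1, j] ++ y)

/-- The graph `G_π` on the reduced words of `π`, whose edges are the commutation moves and the
long braid moves. (A move never fixes a word, so `u ≠ v` only restates that there are no
loops.) -/
def G {n : ℕ} (π : Equiv.Perm (Fin n)) : SimpleGraph (ReducedWord π) where
  Adj u v := u ≠ v ∧
    (CommutationMove u.1 v.1 ∨ CommutationMove v.1 u.1 ∨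
      LongBraidMove u.1 v.1 ∨ LongBraidMove v.1 u.1)
  symm := ⟨fun _ _ h => ⟨h.1.symm, by tauto⟩⟩
  loopless := ⟨fun _ h => h.1 rfl⟩

/-- Contraction: the vertices are the classes of the equivalence relation generated by `c`, and
two different classes are adjacent when `e` relates a member of one to a member of the other. -/
def contraction {V : Type} (c e : V → V → Prop) : SimpleGraph (Quot c) where
  Adj A B := A ≠ B ∧
    ∃ u v : V, Quot.mk c u = A ∧ Quot.mk c v = B ∧ (e u v ∨ e v u)
  symm := ⟨fun _ _ ⟨h, u, v, hu, hv, he⟩ => ⟨h.symm, v, u, hv, hu, he.symm⟩⟩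
  loopless := ⟨fun _ h => h.1 rfl⟩

/-- The graph `C_π`: `G_π` contracted along the commutation edges, so that the vertices are the
commutation classes and the edges come from long braid moves. -/
def C {n : ℕ} (π : Equiv.Perm (Fin n)) :
    SimpleGraph (Quot fun u v : ReducedWord π => CommutationMove u.1 v.1) :=
  contraction _ fun u v => LongBraidMove u.1 v.1

/-- The graph `B_π`: `G_π` contracted along the long braid edges, so that the vertices are the
braid classes and the edges come from commutation moves. -/
def B {n : ℕ} (π : Equiv.Perm (Fin n)) :
    SimpleGraph (Quot fun u v : ReducedWord π => LongBraidMove u.1 v.1) :=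
  contraction _ fun u v => CommutationMove u.1 v.1

end PermGraph

/-! Call reduced words `u`, `v` of `π` opposite if, from every reduced word, suitable paths to `u`
and to `v` use `b` long braid moves and `c` commutation moves in total. Given reduced words `x`,
`y`, the route through `u` and the route through `v` together have length `2 * (b + c)`, so one of
them has length at most `b + c`; counting only one kind of move gives `b` for `C π` and `c` for `B
π`. Two potentials show that this is sharp. The sum of the letters ignores commutation moves and
changes by one in a long braid move; a function `s` ignores long braid moves and changes by at most
one in a commutation move. They differ by `b` and `c` between `u` and `v`. Hence the diameters of `G
π`, `C π`, `B π` are `b + c`, `b`, `c` (`OppositeWords.connected_and_diam_eq`).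

Opposite words are built by recursion on `π = 12[π', 21[1, π'']]` (`OppositeWords.of_decomposes`).
View a reduced word as a diagram of strands. The strand of the largest entry only moves to the left
and crosses just the strands of `π''`; deleting it leaves a shuffle of a reduced word of `π'` and a
shifted reduced word of `π''` (`Decomposes.of_isReducedWord`). One opposite word has the crossings
of this strand last, after `π'` and then `π''`; the other has them first, followed by `π''` and then
`π'`.

With `r` the size of `π''`, the moves towards the two ends add up to a constant, letter by letter
(`exists_rewrites_del`): a letter of `π'` contributes `r` commutations, a letter of `π''`
contributes one braid and `r - 2` commutations. Each pair of a letter of `π'` and a letter of `π''`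
contributes one more commutation, since it is in the wrong order for exactly one end
(`exists_rewrites_shuffle`). The potential `s` records the same costs. Avoidance of 231 passes to
both parts, so the recursion reaches size zero. -/

namespace PermGraph

/-! ### Rewriting words by moves -/

/-- `u` can be rewritten to `v` by `b` long braid moves and `c` commutation moves. -/
inductive Rewrites : ℕ → ℕ → List ℕ → List ℕ → Prop
  | refl (w : List ℕ) : Rewrites 0 0 w w
  | comm {b c : ℕ} {u v w : List ℕ} :
      CommutationMove u v → Rewrites b c v w → Rewrites b (c + 1) u w
  | braid {b c : ℕ} {u v w : List ℕ} :
      LongBraidMove u v → Rewrites b c v w → Rewrites (b + 1) c u w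

theorem CommutationMove.symm {u v : List ℕ} (h : CommutationMove u v) : CommutationMove v u := by
  obtain ⟨x, y, j, k, hjk, rfl, rfl⟩ := h
  exact ⟨x, y, k, j, hjk.symm, rfl, rfl⟩

theorem LongBraidMove.symm {u v : List ℕ} (h : LongBraidMove u v) : LongBraidMove v u := by
  obtain ⟨x, y, j, ⟨rfl, rfl⟩ | ⟨rfl, rfl⟩⟩ := h
  · exact ⟨x, y, j, Or.inr ⟨rfl, rfl⟩⟩
  · exact ⟨x, y, j, Or.inl ⟨rfl, rfl⟩⟩

theorem CommutationMove.append {u v : List ℕ} (h : CommutationMove u v) (x y : List ℕ) :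
    CommutationMove (x ++ u ++ y) (x ++ v ++ y) := by
  obtain ⟨x', y', j, k, hjk, rfl, rfl⟩ := h
  exact ⟨x ++ x', y' ++ y, j, k, hjk, by simp, by simp⟩

theorem LongBraidMove.append {u v : List ℕ} (h : LongBraidMove u v) (x y : List ℕ) :
    LongBraidMove (x ++ u ++ y) (x ++ v ++ y) := by
  obtain ⟨x', y', j, ⟨rfl, rfl⟩ | ⟨rfl, rfl⟩⟩ := h
  · exact ⟨x ++ x', y' ++ y, j, Or.inl ⟨by simp, by simp⟩⟩
  · exact ⟨x ++ x', y' ++ y, j, Or.inr ⟨by simp, by simp⟩⟩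

theorem CommutationMove.map {f : ℕ → ℕ} (hf : ∀ j k, j + 1 < k → f j + 1 < f k)
    {u v : List ℕ} (h : CommutationMove u v) : CommutationMove (u.map f) (v.map f) := by
  obtain ⟨x, y, j, k, hjk, rfl, rfl⟩ := h
  exact ⟨x.map f, y.map f, f j, f k, hjk.imp (hf _ _) (hf _ _), by simp, by simp⟩

theorem LongBraidMove.map_add {u v : List ℕ} (h : LongBraidMove u v) (a : ℕ) :
    LongBraidMove (u.map (· + a)) (v.map (· + a)) := by
  obtain ⟨x, y, j, ⟨rfl, rfl⟩ | ⟨rfl, rfl⟩⟩ := h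
  · exact ⟨x.map (· + a), y.map (· + a), j + a,
      Or.inl ⟨by simp [Nat.add_right_comm], by simp [Nat.add_right_comm]⟩⟩
  · exact ⟨x.map (· + a), y.map (· + a), j + a,
      Or.inr ⟨by simp [Nat.add_right_comm], by simp [Nat.add_right_comm]⟩⟩

namespace Rewrites

variable {b c b' c' : ℕ} {u v w : List ℕ}

theorem trans (h : Rewrites b c u v) (h' : Rewrites b' c' v w) :
    Rewrites (b + b') (c + c') u w := by
  induction h with
  | refl => simpa using h'
  | comm hm _ ih => rw [Nat.add_right_comm]; exact .comm hm (ih h')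
  | braid hm _ ih => rw [Nat.add_right_comm]; exact .braid hm (ih h')

theorem of_comm (h : CommutationMove u v) : Rewrites 0 1 u v := .comm h (.refl _)

theorem of_braid (h : LongBraidMove u v) : Rewrites 1 0 u v := .braid h (.refl _)

theorem symm (h : Rewrites b c u v) : Rewrites b c v u := by
  induction h with
  | refl => exact .refl _
  | comm hm _ ih => exact ih.trans (of_comm hm.symm)
  | braid hm _ ih => exact ih.trans (of_braid hm.symm)

theorem append (h : Rewrites b c u v) (x y : List ℕ) :
    Rewrites b c (x ++ u ++ y) (x ++ v ++ y) := by
  induction h with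
  | refl => exact .refl _
  | comm hm _ ih => exact .comm (hm.append x y) ih
  | braid hm _ ih => exact .braid (hm.append x y) ih

theorem append_left (h : Rewrites b c u v) (x : List ℕ) : Rewrites b c (x ++ u) (x ++ v) := by
  simpa using h.append x []

theorem append_right (h : Rewrites b c u v) (y : List ℕ) : Rewrites b c (u ++ y) (v ++ y) := by
  simpa using h.append [] y

theorem cons (h : Rewrites b c u v) (p : ℕ) : Rewrites b c (p :: u) (p :: v) :=
  h.append_left [p]

theorem map_add (h : Rewrites b c u v) (a : ℕ) :
    Rewrites b c (u.map (· + a)) (v.map (· + a)) := by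
  induction h with
  | refl => exact .refl _
  | comm hm _ ih => exact .comm (hm.map fun j k h => by omega) ih
  | braid hm _ ih => exact .braid (hm.map_add a) ih

/-- Meant for relabellings that open a gap in the alphabet: they keep distant letters distant but
may destroy braids, so only commutations are allowed. The count `b` stays a variable, with an
equation, for the induction. -/
theorem map_of_comm {f : ℕ → ℕ} (hf : ∀ j k, j + 1 < k → f j + 1 < f k)
    (h : Rewrites b c u v) (hb : b = 0) : Rewrites 0 c (u.map f) (v.map f) := by
  induction h with
  | refl => exact .refl _
  | comm hm _ ih => exact .comm (hm.map hf) (ih hb)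
  | braid => omega

theorem cons_far {p : ℕ} (l : List ℕ) (h : ∀ k ∈ l, k + 1 < p ∨ p + 1 < k) :
    Rewrites 0 l.length (p :: l) (l ++ [p]) := by
  induction l with
  | nil => exact .refl _
  | cons k l ih =>
    simp only [List.mem_cons, forall_eq_or_imp] at h
    exact .comm ⟨[], l, p, k, h.1.symm, rfl, rfl⟩ ((ih h.2).cons k)

theorem length_eq (h : Rewrites b c u v) : u.length = v.length := by
  induction h with
  | refl => rfl
  | comm hm _ ih =>
    obtain ⟨x, y, j, k, -, rfl, rfl⟩ := hm
    simpa using ih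
  | braid hm _ ih =>
    obtain ⟨x, y, j, ⟨rfl, rfl⟩ | ⟨rfl, rfl⟩⟩ := hm <;> simpa using ih

theorem mem_iff (h : Rewrites b c u v) (p : ℕ) : p ∈ u ↔ p ∈ v := by
  induction h with
  | refl => rfl
  | comm hm _ ih =>
    obtain ⟨x, y, j, k, -, rfl, rfl⟩ := hm
    rw [← ih]; simp only [List.mem_append, List.mem_cons]; tauto
  | braid hm _ ih =>
    obtain ⟨x, y, j, ⟨rfl, rfl⟩ | ⟨rfl, rfl⟩⟩ := hm <;>
      (rw [← ih]; simp only [List.mem_append, List.mem_cons]; tauto)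

end Rewrites

/-! ### Descending runs -/

/-- The word `q + k - 1, …, q + 1, q`. -/
def desc (q : ℕ) : ℕ → List ℕ
  | 0 => []
  | k + 1 => (q + k) :: desc q k

theorem length_desc (q k : ℕ) : (desc q k).length = k := by
  induction k with
  | zero => rfl
  | succ k ih => simp [desc, ih]

theorem mem_desc {q k p : ℕ} : p ∈ desc q k ↔ q ≤ p ∧ p < q + k := by
  induction k with
  | zero => simp [desc]
  | succ k ih => simp only [desc, List.mem_cons, ih]; omega

theorem desc_add (q i j : ℕ) : desc q (i + j) = desc (q + i) j ++ desc q i := by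
  induction j with
  | zero => rfl
  | succ j ih => simp [desc, ← Nat.add_assoc, ih]

theorem desc_succ (q k : ℕ) : desc q (k + 1) = desc (q + 1) k ++ [q] := by
  rw [Nat.add_comm, desc_add]; rfl

theorem Rewrites.desc_far {q k p : ℕ} (h : p + 1 < q ∨ q + k < p) :
    Rewrites 0 k (desc q k ++ [p]) (p :: desc q k) := by
  have := Rewrites.cons_far (p := p) (desc q k) fun x hx => by
    rw [mem_desc] at hx; omega
  rw [length_desc] at this
  exact this.symm

/-- The letter commutes past the `i` lowest letters of the run, is braided once with the two letters
`q + i + 1, q + i`, and commutes past the `j` highest ones. This is where "one braid and two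
commutations fewer than the length of the run" comes from. -/
theorem Rewrites.desc_braid (q i j : ℕ) :
    Rewrites 1 (i + j) (desc q (i + 2 + j) ++ [q + i + 1]) ((q + i) :: desc q (i + 2 + j)) := by
  have e : desc q (i + 2 + j) = desc (q + i + 2) j ++ [q + i + 1, q + i] ++ desc q i := by
    rw [desc_add, desc_add q i 2]; simp [desc, Nat.add_assoc]
  have h1 : Rewrites 0 i (desc q i ++ [q + i + 1]) ((q + i + 1) :: desc q i) :=
    Rewrites.desc_far (by omega)
  have h2 : Rewrites 1 0 [q + i + 1, q + i, q + i + 1] [q + i, q + i + 1, q + i] :=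
    Rewrites.of_braid ⟨[], [], q + i, Or.inr ⟨rfl, rfl⟩⟩
  have h3 : Rewrites 0 j (desc (q + i + 2) j ++ [q + i]) ((q + i) :: desc (q + i + 2) j) :=
    Rewrites.desc_far (by omega)
  have h4 := ((h1.append_left (desc (q + i + 2) j ++ [q + i + 1, q + i])).trans
    (by simpa using h2.append (desc (q + i + 2) j) (desc q i))).trans
    (by simpa using h3.append_right ([q + i + 1, q + i] ++ desc q i))
  rw [e]
  simpa using h4

/-! ### Deleting a strand -/

/-- The position after the letter `p` of the strand that is at position `q` before it, provided
that `p ≠ q`. -/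
def step (q p : ℕ) : ℕ := if p + 1 = q then p else q

/-- The final position of a strand that starts at position `q` and moves to the left. -/
def dest : ℕ → List ℕ → ℕ
  | q, [] => q
  | q, p :: y => dest (step q p) y

/-- The word that remains when the strand that starts at position `q` and moves to the left is
deleted. -/
def del : ℕ → List ℕ → List ℕ
  | _, [] => []
  | q, p :: y =>
    (if p + 1 = q then [] else if p < q then [p] else [p - 1]) ++ del (step q p) y

/-- The number of commutation moves needed to move the crossings of the strand that starts at
position `T` behind all other letters; the strand is now at position `q`. -/
def cost (T : ℕ) : ℕ → List ℕ → ℤ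
  | _, [] => 0
  | q, p :: y =>
    (if p + 1 = q then 0 else if p < q then (T : ℤ) - q else (T : ℤ) - q - 2) +
      cost T (step q p) y

/-- The letters are less than `T` and the strand at position `q` never moves to the right. -/
def Passable (T : ℕ) : ℕ → List ℕ → Prop
  | _, [] => True
  | q, p :: y => p < T ∧ p ≠ q ∧ Passable T (step q p) y

theorem dest_append (q : ℕ) (x y : List ℕ) : dest q (x ++ y) = dest (dest q x) y := by
  induction x generalizing q with
  | nil => rfl
  | cons p x ih => simp [dest, ih]

theorem del_append (q : ℕ) (x y : List ℕ) : del q (x ++ y) = del q x ++ del (dest q x) y := by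
  induction x generalizing q with
  | nil => rfl
  | cons p x ih => simp [dest, del, ih]

theorem cost_append (T q : ℕ) (x y : List ℕ) :
    cost T q (x ++ y) = cost T q x + cost T (dest q x) y := by
  induction x generalizing q with
  | nil => simp [cost, dest]
  | cons p x ih => simp [dest, cost, ih, add_assoc]

theorem passable_append {T q : ℕ} {x y : List ℕ} :
    Passable T q (x ++ y) ↔ Passable T q x ∧ Passable T (dest q x) y := by
  induction x generalizing q with
  | nil => simp [Passable, dest]
  | cons p x ih => simp [dest, Passable, ih, and_assoc]

theorem step_le (q p : ℕ) : step q p ≤ q := by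
  unfold step; split <;> omega

theorem dest_le (q : ℕ) (y : List ℕ) : dest q y ≤ q := by
  induction y generalizing q with
  | nil => exact le_rfl
  | cons p y ih => exact (ih _).trans (step_le q p)

theorem del_lt {T q : ℕ} {y : List ℕ} (h : Passable T q y) (hq : q ≤ T) :
    ∀ p ∈ del q y, p + 1 < T := by
  induction y generalizing q with
  | nil => simp [del]
  | cons k y ih =>
    obtain ⟨h1, h2, h3⟩ := h
    intro p hp
    simp only [del, List.mem_append] at hp
    rcases hp with hp | hp
    · split_ifs at hp <;> simp at hp <;> omega
    · exact ih h3 ((step_le q k).trans hq) p hp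

/-- The crossings of a strand can be moved behind all other letters, or in front of them. The
numbers of moves that these need have a sum that only depends on the other letters. -/
theorem exists_rewrites_del {T a q : ℕ} {y : List ℕ} (h : Passable T q y) (hq : q ≤ T)
    (hy : dest q y = a) :
    ∃ b₁ c₁, Rewrites b₁ c₁ (desc q (T - q) ++ y) (del q y ++ desc a (T - a)) ∧
      ((∀ p ∈ del q y, p + 1 ≠ a) → ∃ b₂ c₂,
        Rewrites b₂ c₂ y
          (desc a (q - a) ++ (del q y).map fun p => if p < a then p else p + 1) ∧
        b₁ + b₂ = (del q y).countP (a ≤ ·) ∧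
        c₁ + c₂ = (T - a) * (del q y).countP (· < a) +
          (T - a - 2) * (del q y).countP (a ≤ ·)) := by
  induction y generalizing q with
  | nil =>
    obtain rfl : q = a := hy
    exact ⟨0, 0, by simpa [del] using Rewrites.refl _, fun _ =>
      ⟨0, 0, by simpa [desc, del] using Rewrites.refl _, by simp [del], by simp [del]⟩⟩
  | cons p y ih =>
    obtain ⟨h1, h2, h3⟩ := h
    have haq : a ≤ step q p := by rw [← hy]; exact dest_le _ y
    obtain ⟨b₁, c₁, hr, hs⟩ := ih h3 ((step_le q p).trans hq) hy
    -- If `p + 1 = q`, the letter is a crossing of the strand itself and only lengthens the run. Any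
    -- other letter has to pass the run on one side for the first target and the run on the other
    -- side for the second.
    by_cases hpq : p + 1 = q
    · have hst : step q p = p := by simp [step, hpq]
      have hd : del q (p :: y) = del p y := by simp [del, hst, hpq]
      rw [hd]
      rw [hst] at hr hs haq
      subst hpq
      refine ⟨b₁, c₁, ?_, fun hm => ?_⟩
      · obtain ⟨k, rfl⟩ : ∃ k, T = p + 1 + k := ⟨T - (p + 1), by omega⟩
        have e1 : p + 1 + k - p = k + 1 := by omega
        have e2 : p + 1 + k - (p + 1) = k := by omega
        rw [e1, desc_succ] at hr
        rw [e2]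
        simpa using hr
      · obtain ⟨b₂, c₂, hr2, hb, hc⟩ := hs hm
        refine ⟨b₂, c₂, ?_, hb, hc⟩
        obtain ⟨k, rfl⟩ : ∃ k, p = a + k := ⟨p - a, by omega⟩
        have e1 : a + k - a = k := by omega
        have e2 : a + k + 1 - a = k + 1 := by omega
        rw [e1] at hr2
        rw [e2]
        exact hr2.cons _
    · have hst : step q p = q := by simp [step, hpq]
      rw [hst] at hr hs haq
      by_cases hlt : p < q
      · have hd : del q (p :: y) = p :: del q y := by simp [del, hst, hpq, hlt]
        rw [hd]
        have hl : Rewrites 0 (T - q) (desc q (T - q) ++ [p]) (p :: desc q (T - q)) :=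
          Rewrites.desc_far (by omega)
        have hl' := (hl.append_right y).trans (by simpa using hr.cons p)
        refine ⟨_, _, by simpa using hl', fun hm => ?_⟩
        simp only [List.mem_cons, forall_eq_or_imp] at hm
        obtain ⟨b₂, c₂, hr2, hb, hc⟩ := hs hm.2
        -- A letter below `a` commutes with both runs, which costs `(T - q) + (q - a) = T - a`. A
        -- letter from `a` on commutes with the first run but lies inside the second: one braid and
        -- `(T - q) + (q - a - 2)` commutations.
        by_cases hpa : p < a
        · have hf := (Rewrites.desc_far (q := a) (k := q - a) (p := p) (by omega)).symm
          have hf' := (hr2.cons p).trans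
            (hf.append_right ((del q y).map fun p => if p < a then p else p + 1))
          refine ⟨_, _, by simpa [hpa] using hf', ?_, ?_⟩
          · simp [hpa]; omega
          · simp only [List.countP_cons, hpa, decide_true, if_true, not_le.2 hpa, decide_false]
            have : T - a = (T - q) + (q - a) := by omega
            simp only [Bool.false_eq_true, if_false]
            rw [Nat.mul_add, Nat.add_zero]
            omega
        · obtain ⟨i, rfl⟩ : ∃ i, p = a + i := ⟨p - a, by omega⟩
          obtain ⟨j, rfl⟩ : ∃ j, q = a + i + 2 + j := ⟨q - (a + i + 2), by omega⟩
          have e1 : a + i + 2 + j - a = i + 2 + j := by omega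
          rw [e1] at hr2 ⊢
          have hf := (Rewrites.desc_braid a i j).symm
          have hf' := (hr2.cons (a + i)).trans
            (hf.append_right ((del _ y).map fun p => if p < a then p else p + 1))
          refine ⟨_, _, by simpa using hf', ?_, ?_⟩
          · simp; omega
          · simp only [List.countP_cons, hpa, decide_false, Nat.le_add_right, decide_true, if_true,
              Bool.false_eq_true, if_false, Nat.mul_add]
            omega
      -- Now the letter is to the right of the strand, and the roles are exchanged: it is braided
      -- through the first run and commutes with the second. The total is the same.
      · obtain ⟨i, rfl⟩ : ∃ i, p = q + i + 1 := ⟨p - q - 1, by omega⟩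
        obtain ⟨j, rfl⟩ : ∃ j, T = q + i + 2 + j := ⟨T - (q + i + 2), by omega⟩
        have hd : del q ((q + i + 1) :: y) = (q + i) :: del q y := by
          simp [del, hst, hlt, hpq]
        rw [hd]
        have e1 : q + i + 2 + j - q = i + 2 + j := by omega
        rw [e1] at hr ⊢
        have hl' := ((Rewrites.desc_braid q i j).append_right y).trans
          (by simpa using hr.cons (q + i))
        refine ⟨_, _, by simpa using hl', fun hm => ?_⟩
        simp only [List.mem_cons, forall_eq_or_imp] at hm
        obtain ⟨b₂, c₂, hr2, hb, hc⟩ := hs hm.2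
        have hqa : ¬ q + i < a := by omega
        have hf := (Rewrites.desc_far (q := a) (k := q - a) (p := q + i + 1) (by omega)).symm
        have hf' := (hr2.cons (q + i + 1)).trans
          (hf.append_right ((del q y).map fun p => if p < a then p else p + 1))
        refine ⟨_, _, by simpa [hqa] using hf', ?_, ?_⟩
        · simp [not_lt.1 hqa]; omega
        · simp only [List.countP_cons, hqa, decide_false, not_lt.1 hqa, decide_true, if_true,
            Bool.false_eq_true, if_false, Nat.mul_add]
          omega

/-! ### The effect of moves on the deletion of a strand -/

/-- If one of the letters moves the strand, the other survives alone, and its cost is computed for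
strand positions that differ by one. If neither does, both survive; closing the gap left by the
strand keeps them distant, as neither letter touches it. -/
theorem del_comm {T q j k : ℕ} (hjk : j + 1 < k ∨ k + 1 < j) (h : Passable T q [j, k])
    (h' : Passable T q [k, j]) :
    dest q [j, k] = dest q [k, j] ∧
      ((del q [j, k] = del q [k, j] ∧ |cost T q [j, k] - cost T q [k, j]| ≤ 1) ∨
        ((∃ j' k', (j' + 1 < k' ∨ k' + 1 < j') ∧ del q [j, k] = [j', k'] ∧
          del q [k, j] = [k', j']) ∧ cost T q [j, k] = cost T q [k, j])) := by
  obtain ⟨-, h1, -, h2, -⟩ := h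
  obtain ⟨-, h3, -, h4, -⟩ := h'
  by_cases hj : j + 1 = q
  · have hk : k ≠ j := by omega
    have hk' : k + 1 ≠ j := by omega
    have e : (k < q) = (k < j) := by apply propext; omega
    subst hj
    refine ⟨by simp [dest, step, hk, hk'], Or.inl ⟨?_, ?_⟩⟩
    · simp [del, step, hk, hk', e]
    · by_cases hkj : k < j
      · simp [cost, step, hk, hk', hkj, e]
      · simp [cost, step, hk, hk', hkj, e]
  · by_cases hk : k + 1 = q
    · have hj' : j ≠ k := by omega
      have hk' : j + 1 ≠ k := by omega
      have e : (j < q) = (j < k) := by apply propext; omega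
      subst hk
      refine ⟨by simp [dest, step, hj', hk'], Or.inl ⟨?_, ?_⟩⟩
      · simp [del, step, hj', hk', e]
      · by_cases hkj : j < k
        · simp [cost, step, hj', hk', hkj, e]
        · simp [cost, step, hj', hk', hkj, e]
    · refine ⟨by simp [dest, step, hj, hk], Or.inr ⟨⟨if j < q then j else j - 1,
        if k < q then k else k - 1, ?_, ?_, ?_⟩, ?_⟩⟩
      · split_ifs <;> omega
      · simp only [del, step, hj, hk, if_false]; split_ifs <;> simp
      · simp only [del, step, hj, hk, if_false]; split_ifs <;> simp
      · simp only [cost, step, hj, hk, if_false]; ring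

/-- If the strand takes part in the braid, it starts at `j + 2` and ends at `j`, and one letter
survives: to the left of the strand before its two crossings, or to the right after them. The costs
`T - (j + 2)` and `T - j - 2` agree, which explains the `- 2` in `cost`. Otherwise all three letters
survive and still form a braid. -/
theorem del_braid {T q j : ℕ} (h : Passable T q [j, j + 1, j])
    (h' : Passable T q [j + 1, j, j + 1]) :
    dest q [j, j + 1, j] = dest q [j + 1, j, j + 1] ∧
      cost T q [j, j + 1, j] = cost T q [j + 1, j, j + 1] ∧
      (del q [j, j + 1, j] = del q [j + 1, j, j + 1] ∨
        ∃ i, del q [j, j + 1, j] = [i, i + 1, i] ∧ del q [j + 1, j, j + 1] = [i + 1, i, i + 1]) := by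
  obtain ⟨-, h1, -, h2, -⟩ := h
  obtain ⟨-, h3, -⟩ := h'
  have hj : j + 1 ≠ q := fun e => h3 e
  by_cases hq : j + 2 = q
  · subst hq
    have hne : j + 1 + 1 ≠ j := by omega
    refine ⟨by simp [dest, step, hne], ?_, Or.inl ?_⟩
    · simp [cost, step, hne]; ring
    · simp [del, step, hne]
  · have hq' : j + 1 + 1 ≠ q := hq
    have e : (j + 1 < q) = (j < q) := by apply propext; omega
    refine ⟨by simp [dest, step, hj, hq'], ?_, Or.inr ⟨if j < q then j else j - 1, ?_, ?_⟩⟩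
    · simp [cost, step, hj, hq', e]
    · by_cases hlt : j < q
      · simp [del, step, hj, hq', e, hlt]
      · simp [del, step, hj, hq', e, hlt]; omega
    · by_cases hlt : j < q
      · simp [del, step, hj, hq', e, hlt]
      · simp [del, step, hj, hq', e, hlt]; omega

theorem CommutationMove.del {T q : ℕ} {u v : List ℕ} (h : CommutationMove u v)
    (hu : Passable T q u) (hv : Passable T q v) :
    (del q u = del q v ∧ |cost T q u - cost T q v| ≤ 1) ∨
      (CommutationMove (del q u) (del q v) ∧ cost T q u = cost T q v) := by
  obtain ⟨x, y, j, k, hjk, rfl, rfl⟩ := h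
  rw [passable_append, passable_append] at hu hv
  obtain ⟨hd, h⟩ := del_comm hjk hu.1.2 hv.1.2
  simp only [del_append, cost_append, dest_append, hd]
  rcases h with ⟨h1, h2⟩ | ⟨⟨j', k', hjk', h1, h2⟩, h3⟩
  · exact Or.inl ⟨by rw [h1], by simpa using h2⟩
  · exact Or.inr ⟨⟨_, _, j', k', hjk', by rw [h1], by rw [h2]⟩, by rw [h3]⟩

theorem LongBraidMove.del {T q : ℕ} {u v : List ℕ} (h : LongBraidMove u v)
    (hu : Passable T q u) (hv : Passable T q v) :
    (del q u = del q v ∨ LongBraidMove (del q u) (del q v)) ∧ cost T q u = cost T q v := by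
  have key : ∀ (x y : List ℕ) (j : ℕ), Passable T q (x ++ [j, j + 1, j] ++ y) →
      Passable T q (x ++ [j + 1, j, j + 1] ++ y) →
      (PermGraph.del q (x ++ [j, j + 1, j] ++ y) = PermGraph.del q (x ++ [j + 1, j, j + 1] ++ y) ∨
        LongBraidMove (PermGraph.del q (x ++ [j, j + 1, j] ++ y))
          (PermGraph.del q (x ++ [j + 1, j, j + 1] ++ y))) ∧
        cost T q (x ++ [j, j + 1, j] ++ y) = cost T q (x ++ [j + 1, j, j + 1] ++ y) := by
    intro x y j hu hv
    rw [passable_append, passable_append] at hu hv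
    obtain ⟨hd, hc, h⟩ := del_braid hu.1.2 hv.1.2
    simp only [del_append, cost_append, dest_append, hd, hc]
    refine ⟨?_, trivial⟩
    rcases h with h1 | ⟨i, h1, h2⟩
    · exact Or.inl (by rw [h1])
    · exact Or.inr ⟨_, _, i, Or.inl ⟨by rw [h1], by rw [h2]⟩⟩
  obtain ⟨x, y, j, ⟨rfl, rfl⟩ | ⟨rfl, rfl⟩⟩ := h
  · exact key x y j hu hv
  · obtain ⟨h1, h2⟩ := key x y j hv hu
    exact ⟨h1.imp Eq.symm LongBraidMove.symm, h2.symm⟩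

/-! ### Shuffles of small and big letters -/

/-- The letters less than `a`. -/
def small (a : ℕ) (w : List ℕ) : List ℕ := w.filter (· < a)

/-- The letters that are at least `a`, diminished by `a`. -/
def big (a : ℕ) (w : List ℕ) : List ℕ := (w.filter (a ≤ ·)).map (· - a)

/-- The number of pairs of a letter that is at least `a` and a later letter that is less than
`a`. -/
def mixed (a : ℕ) : List ℕ → ℤ
  | [] => 0
  | p :: w => (if p < a then 0 else ((small a w).length : ℤ)) + mixed a w

theorem small_append (a : ℕ) (x y : List ℕ) : small a (x ++ y) = small a x ++ small a y := by
  simp [small]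

theorem big_append (a : ℕ) (x y : List ℕ) : big a (x ++ y) = big a x ++ big a y := by
  simp [big]

theorem mixed_append (a : ℕ) (x y : List ℕ) :
    mixed a (x ++ y) = mixed a x + mixed a y + (big a x).length * (small a y).length := by
  induction x with
  | nil => simp [mixed, big]
  | cons p x ih =>
    simp only [List.cons_append, mixed, ih, small_append]
    by_cases hp : p < a
    · have : big a (p :: x) = big a x := by simp [big, hp]
      simp [hp, this]
    · have : big a (p :: x) = (p - a) :: big a x := by simp [big, not_lt.1 hp]
      simp [hp, this]; ring

theorem small_of_lt {a : ℕ} {w : List ℕ} (h : ∀ p ∈ w, p < a) : small a w = w := by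
  simpa [small] using h

theorem big_of_lt {a : ℕ} {w : List ℕ} (h : ∀ p ∈ w, p < a) : big a w = [] := by
  simpa [big] using h

theorem small_map_add (a : ℕ) (w : List ℕ) : small a (w.map (· + a)) = [] := by
  simp [small]

theorem big_map_add (a : ℕ) (w : List ℕ) : big a (w.map (· + a)) = w := by
  induction w with
  | nil => rfl
  | cons p w ih => simp_all [big]

theorem mixed_of_lt {a : ℕ} {w : List ℕ} (h : ∀ p ∈ w, p < a) : mixed a w = 0 := by
  induction w with
  | nil => rfl
  | cons p w ih => simp only [List.mem_cons, forall_eq_or_imp] at h; simp [mixed, h.1, ih h.2]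

theorem mixed_map_add (a : ℕ) (w : List ℕ) : mixed a (w.map (· + a)) = 0 := by
  induction w with
  | nil => rfl
  | cons p w ih => simp only [List.map_cons, mixed, small_map_add, ih]; simp

theorem length_small (a : ℕ) (w : List ℕ) : (small a w).length = w.countP (· < a) := by
  rw [small, List.countP_eq_length_filter]

theorem length_big (a : ℕ) (w : List ℕ) : (big a w).length = w.countP (a ≤ ·) := by
  rw [big, List.length_map, List.countP_eq_length_filter]

/-- Without the letter `a - 1`, every small letter commutes with every big one. Each such pair needs
a switch for exactly one of the two targets. -/
theorem exists_rewrites_shuffle {a : ℕ} {w : List ℕ} (h : ∀ p ∈ w, p + 1 ≠ a) :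
    ∃ c₁ c₂, Rewrites 0 c₁ w (small a w ++ (big a w).map (· + a)) ∧
      Rewrites 0 c₂ w ((big a w).map (· + a) ++ small a w) ∧
      c₁ + c₂ = (small a w).length * (big a w).length := by
  have hs : ∀ w : List ℕ, (∀ p ∈ w, p + 1 ≠ a) → ∀ k ∈ small a w, k + 1 < a := by
    intro w h k hk
    simp only [small, List.mem_filter, decide_eq_true_eq] at hk
    have := h k hk.1
    omega
  have hb : ∀ w : List ℕ, ∀ k ∈ (big a w).map (· + a), a ≤ k := by
    intro w k hk
    simp only [List.mem_map] at hk
    omega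
  induction w with
  | nil => exact ⟨0, 0, .refl _, .refl _, rfl⟩
  | cons p w ih =>
    have h0 := h
    simp only [List.mem_cons, forall_eq_or_imp] at h
    obtain ⟨c₁, c₂, h1, h2, h3⟩ := ih h.2
    by_cases hp : p < a
    · have e1 : small a (p :: w) = p :: small a w := by simp [small, hp]
      have e2 : big a (p :: w) = big a w := by simp [big, hp]
      rw [e1, e2]
      have hf := Rewrites.cons_far (p := p) ((big a w).map (· + a)) fun k hk =>
        Or.inr (by have := hb w k hk; omega)
      have hf' := (h2.cons p).trans (hf.append_right (small a w))
      refine ⟨_, _, h1.cons p, by simpa using hf', ?_⟩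
      simp only [List.length_cons, Nat.add_mul, one_mul, ← h3]
      omega
    · have e1 : small a (p :: w) = small a w := by simp [small, hp]
      have e2 : big a (p :: w) = (p - a) :: big a w := by simp [big, not_lt.1 hp]
      have e3 : p - a + a = p := by omega
      rw [e1, e2, List.map_cons, e3]
      have hf := Rewrites.cons_far (p := p) (small a w) fun k hk =>
        Or.inl (by have := hs w h.2 k hk; omega)
      have hf' := (h1.cons p).trans (hf.append_right ((big a w).map (· + a)))
      refine ⟨_, _, by simpa using hf', h2.cons p, ?_⟩
      simp only [List.length_cons, Nat.mul_add, mul_one, ← h3]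
      omega

theorem CommutationMove.shuffle {a : ℕ} {u v : List ℕ} (h : CommutationMove u v) :
    (CommutationMove (small a u) (small a v) ∧ big a u = big a v ∧ mixed a u = mixed a v) ∨
      (small a u = small a v ∧ CommutationMove (big a u) (big a v) ∧ mixed a u = mixed a v) ∨
      (small a u = small a v ∧ big a u = big a v ∧ |mixed a u - mixed a v| ≤ 1) := by
  obtain ⟨x, y, j, k, hjk, rfl, rfl⟩ := h
  simp only [small_append, big_append, mixed_append]
  by_cases hj : j < a <;> by_cases hk : k < a
  · refine Or.inl ⟨⟨small a x, small a y, j, k, hjk, by simp [small, hj, hk],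
      by simp [small, hj, hk]⟩, by simp [big, hj, hk], by simp [mixed, small, big, hj, hk]⟩
  · have hj' := not_le.2 hj
    rw [not_lt] at hk
    refine Or.inr (Or.inr ⟨by simp [small, hj, hk], by simp [big, hj', hk], ?_⟩)
    simp [mixed, small, big, hj, hj', hk, not_lt.2 hk]
  · have hk' := not_le.2 hk
    rw [not_lt] at hj
    refine Or.inr (Or.inr ⟨by simp [small, hj, hk], by simp [big, hj, hk'], ?_⟩)
    simp [mixed, small, big, hk, hk', hj, not_lt.2 hj]
  · rw [not_lt] at hj hk
    refine Or.inr (Or.inl ⟨by simp [small, hj, hk], ⟨big a x, big a y, j - a, k - a, by omega,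
      by simp [big, hj, hk], by simp [big, hj, hk]⟩, by simp [mixed, small, big, hj, hk]⟩)

/-- Since `a - 1` does not occur, the letters `j` and `j + 1` of a braid lie on the same side of
`a`. -/
theorem LongBraidMove.shuffle {a : ℕ} {u v : List ℕ} (h : LongBraidMove u v)
    (ha : ∀ p ∈ u, p + 1 ≠ a) :
    ((LongBraidMove (small a u) (small a v) ∧ big a u = big a v) ∨
      (small a u = small a v ∧ LongBraidMove (big a u) (big a v))) ∧ mixed a u = mixed a v := by
  have key : ∀ (x y : List ℕ) (j : ℕ), j + 1 ≠ a →
      ((LongBraidMove (small a (x ++ [j, j + 1, j] ++ y)) (small a (x ++ [j + 1, j, j + 1] ++ y)) ∧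
          big a (x ++ [j, j + 1, j] ++ y) = big a (x ++ [j + 1, j, j + 1] ++ y)) ∨
        (small a (x ++ [j, j + 1, j] ++ y) = small a (x ++ [j + 1, j, j + 1] ++ y) ∧
          LongBraidMove (big a (x ++ [j, j + 1, j] ++ y)) (big a (x ++ [j + 1, j, j + 1] ++ y)))) ∧
        mixed a (x ++ [j, j + 1, j] ++ y) = mixed a (x ++ [j + 1, j, j + 1] ++ y) := by
    intro x y j hja
    simp only [small_append, big_append, mixed_append]
    by_cases hj : j < a
    · have hj' : j + 1 < a := by omega
      exact ⟨Or.inl ⟨⟨small a x, small a y, j, Or.inl ⟨by simp [small, hj, hj'],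
        by simp [small, hj, hj']⟩⟩, by simp [big, hj, hj']⟩, by simp [mixed, small, big, hj, hj']⟩
    · have hj' : ¬ j + 1 < a := by omega
      have e : j + 1 - a = j - a + 1 := by omega
      rw [not_lt] at hj hj'
      exact ⟨Or.inr ⟨by simp [small, hj, hj'], ⟨big a x, big a y, j - a,
        Or.inl ⟨by simp [big, hj, hj', e], by simp [big, hj, hj', e]⟩⟩⟩,
        by simp [mixed, small, big, hj, hj']⟩
  obtain ⟨x, y, j, ⟨rfl, rfl⟩ | ⟨rfl, rfl⟩⟩ := h
  · exact key x y j (ha j (by simp))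
  · obtain ⟨h1, h2⟩ := key x y j (ha j (by simp))
    exact ⟨h1.imp (fun h => ⟨h.1.symm, h.2.symm⟩) fun h => ⟨h.1.symm, h.2.symm⟩, h2.symm⟩

/-! ### Words as permutations of the natural numbers -/

/-- The product of the simple reflections of a word, as a permutation of `ℕ`. -/
def wordPerm (w : List ℕ) : Equiv.Perm ℕ := (w.map fun i => Equiv.swap i (i + 1)).prod

theorem wordPerm_nil : wordPerm [] = 1 := rfl

theorem wordPerm_cons (p : ℕ) (w : List ℕ) :
    wordPerm (p :: w) = Equiv.swap p (p + 1) * wordPerm w := by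
  simp [wordPerm]

theorem wordPerm_append (x y : List ℕ) : wordPerm (x ++ y) = wordPerm x * wordPerm y := by
  simp [wordPerm]

theorem swap_apply_of_far {p x : ℕ} (h : x < p ∨ p + 1 < x) : Equiv.swap p (p + 1) x = x :=
  Equiv.swap_apply_of_ne_of_ne (by omega) (by omega)

theorem swap_apply_nat (p x : ℕ) :
    Equiv.swap p (p + 1) x = if x = p then p + 1 else if x = p + 1 then p else x :=
  Equiv.swap_apply_def _ _ _

theorem Rewrites.wordPerm_eq {b c : ℕ} {u v : List ℕ} (h : Rewrites b c u v) :
    wordPerm u = wordPerm v := by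
  induction h with
  | refl => rfl
  | comm hm _ ih =>
    obtain ⟨x, y, j, k, hjk, rfl, rfl⟩ := hm
    rw [← ih]
    simp only [wordPerm_append]
    congr 2
    ext z
    simp only [wordPerm_cons, wordPerm_nil, Equiv.Perm.mul_apply, Equiv.Perm.one_apply,
      swap_apply_nat]
    split_ifs <;> omega
  | braid hm _ ih =>
    -- Both products are the transposition of `j` and `j + 2`.
    have key : ∀ j, wordPerm [j, j + 1, j] = wordPerm [j + 1, j, j + 1] := by
      intro j
      have h1 := Equiv.swap_mul_swap_mul_swap (x := j + 2) (y := j + 1) (z := j) (by omega)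
        (by omega)
      have h2 := Equiv.swap_mul_swap_mul_swap (x := j) (y := j + 1) (z := j + 2) (by omega)
        (by omega)
      rw [Equiv.swap_comm (j + 1) j, Equiv.swap_comm (j + 2) (j + 1)] at h1
      rw [Equiv.swap_comm (j + 2) j] at h2
      simp only [wordPerm_cons, wordPerm_nil, mul_one, ← mul_assoc]
      exact h1.trans h2.symm
    obtain ⟨x, y, j, ⟨rfl, rfl⟩ | ⟨rfl, rfl⟩⟩ := hm <;>
      rw [← ih] <;> simp only [wordPerm_append, key]

theorem wordPerm_lt {N : ℕ} {w : List ℕ} (h : ∀ p ∈ w, p + 1 < N) {x : ℕ} (hx : x < N) :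
    wordPerm w x < N := by
  induction w with
  | nil => exact hx
  | cons p w ih =>
    simp only [List.mem_cons, forall_eq_or_imp] at h
    have := ih h.2
    rw [wordPerm_cons, Equiv.Perm.mul_apply, swap_apply_nat]
    split_ifs <;> omega

theorem wordPerm_of_le {N : ℕ} {w : List ℕ} (h : ∀ p ∈ w, p + 1 < N) {x : ℕ} (hx : N ≤ x) :
    wordPerm w x = x := by
  induction w with
  | nil => rfl
  | cons p w ih =>
    simp only [List.mem_cons, forall_eq_or_imp] at h
    rw [wordPerm_cons, Equiv.Perm.mul_apply, ih h.2]
    exact swap_apply_of_far (by omega)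

theorem wordPerm_lt_iff {a : ℕ} {w : List ℕ} (h : ∀ p ∈ w, p + 1 ≠ a) (x : ℕ) :
    wordPerm w x < a ↔ x < a := by
  induction w with
  | nil => rfl
  | cons p w ih =>
    simp only [List.mem_cons, forall_eq_or_imp] at h
    rw [wordPerm_cons, Equiv.Perm.mul_apply, swap_apply_nat, ← ih h.2]
    split_ifs <;> omega

theorem wordPerm_map_add_of_lt {a x : ℕ} (w : List ℕ) (h : x < a) :
    wordPerm (w.map (· + a)) x = x := by
  induction w with
  | nil => rfl
  | cons p w ih =>
    rw [List.map_cons, wordPerm_cons, Equiv.Perm.mul_apply, ih]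
    exact swap_apply_of_far (by omega)

theorem wordPerm_map_add (a x : ℕ) (w : List ℕ) :
    wordPerm (w.map (· + a)) (a + x) = a + wordPerm w x := by
  induction w with
  | nil => rfl
  | cons p w ih =>
    simp only [List.map_cons, wordPerm_cons, Equiv.Perm.mul_apply, ih, swap_apply_nat]
    split_ifs <;> omega

theorem wordPerm_desc_of_lt {a x : ℕ} (k : ℕ) (h : x < a) : wordPerm (desc a k) x = x := by
  induction k with
  | zero => rfl
  | succ k ih =>
    rw [desc, wordPerm_cons, Equiv.Perm.mul_apply, ih]
    exact swap_apply_of_far (by omega)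

theorem wordPerm_desc_self (a k : ℕ) : wordPerm (desc a k) a = a + k := by
  induction k with
  | zero => rfl
  | succ k ih =>
    rw [desc, wordPerm_cons, Equiv.Perm.mul_apply, ih, Equiv.swap_apply_left]; rfl

theorem wordPerm_desc_add (a k j : ℕ) :
    wordPerm (desc a k) (a + 1 + j) = if j < k then a + j else a + 1 + j := by
  induction k with
  | zero => rfl
  | succ k ih =>
    rw [desc, wordPerm_cons, Equiv.Perm.mul_apply, ih, swap_apply_nat]
    split_ifs <;> omega

/-- This identifies the end of the tracked strand as the position of the entry `q`, so that for the
largest entry it can be read off from the permutation. -/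
theorem wordPerm_dest {T q : ℕ} {y : List ℕ} (h : Passable T q y) :
    wordPerm y (dest q y) = q := by
  induction y generalizing q with
  | nil => rfl
  | cons p y ih =>
    obtain ⟨-, h2, h3⟩ := h
    rw [dest, wordPerm_cons, Equiv.Perm.mul_apply, ih h3, swap_apply_nat, step]
    split_ifs <;> omega

/-! ### Ascending words -/

/-- Every letter of the word exchanges two entries that are in increasing order. -/
def Ascending (w : List ℕ) : Prop :=
  ∀ (x : List ℕ) (p : ℕ) (y : List ℕ), w = x ++ p :: y → wordPerm x p < wordPerm x (p + 1)

theorem Ascending.of_append {x y : List ℕ} (h : Ascending (x ++ y)) : Ascending x := by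
  intro x' p y' e
  exact h x' p (y' ++ y) (by simp [e])

/-- The exchange condition: delete the letter that inverted the two entries now at `p` and `p + 1`.
If no later letter has already done so, the first letter `t` did; then the tail sends `p, p + 1` to
`t, t + 1`, and the new swap cancels `t`. -/
theorem exists_wordPerm_mul_swap {x : List ℕ} {p : ℕ} (h : wordPerm x (p + 1) < wordPerm x p) :
    ∃ z : List ℕ, z.length + 1 = x.length ∧ (∀ i ∈ z, i ∈ x) ∧
      wordPerm z = wordPerm x * Equiv.swap p (p + 1) := by
  induction x with
  | nil => simp [wordPerm_nil] at h
  | cons t x ih =>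
    by_cases hx : wordPerm x (p + 1) < wordPerm x p
    · obtain ⟨z, hz, hm, he⟩ := ih hx
      refine ⟨t :: z, by simp [hz], ?_, by rw [wordPerm_cons, wordPerm_cons, he, mul_assoc]⟩
      simp only [List.mem_cons, forall_eq_or_imp, true_or, true_and]
      exact fun i hi => Or.inr (hm i hi)
    · refine ⟨x, rfl, fun i hi => List.mem_cons_of_mem _ hi, ?_⟩
      have hne : wordPerm x p ≠ wordPerm x (p + 1) := fun e => by
        have := (wordPerm x).injective e
        omega
      simp only [wordPerm_cons, Equiv.Perm.mul_apply, swap_apply_nat] at h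
      have h1 : wordPerm x p = t ∧ wordPerm x (p + 1) = t + 1 := by
        split_ifs at h <;> omega
      rw [wordPerm_cons, mul_assoc, Equiv.mul_swap_eq_swap_mul, h1.1, h1.2, ← mul_assoc,
        Equiv.swap_mul_self, one_mul]

/-- The first letter `a - 1` puts an entry that is at least `a` to the left of one that is less than
`a`. An ascending word never undoes an inversion, so this would be visible in the final permutation.
-/
theorem Ascending.not_mem {a : ℕ} {w : List ℕ} (h : Ascending w)
    (hw : ∀ x, wordPerm w x < a ↔ x < a) : ∀ p ∈ w, p + 1 ≠ a := by
  have key : ∀ w : List ℕ, Ascending w → (∃ p ∈ w, p + 1 = a) →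
      ∃ i j, i < j ∧ wordPerm w j < a ∧ a ≤ wordPerm w i := by
    intro w
    induction w using List.reverseRecOn with
    | nil => simp
    | append_singleton x p ih =>
      rintro ha ⟨k, hk, hka⟩
      have hp := ha x p [] rfl
      have hq : ∀ z, wordPerm (x ++ [p]) z = wordPerm x (Equiv.swap p (p + 1) z) := by
        intro z
        simp [wordPerm_append, wordPerm_cons, wordPerm_nil]
      by_cases hx : ∃ k ∈ x, k + 1 = a
      · obtain ⟨i, j, hij, hj, hi⟩ := ih ha.of_append hx
        refine ⟨Equiv.swap p (p + 1) i, Equiv.swap p (p + 1) j, ?_, ?_, ?_⟩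
        -- Only a swap of exactly these two positions could reverse the pair, but the entries there
        -- are in decreasing order.
        · have : ¬ (i = p ∧ j = p + 1) := by rintro ⟨rfl, rfl⟩; omega
          rw [swap_apply_nat, swap_apply_nat]
          split_ifs <;> omega
        · rwa [hq, Equiv.swap_apply_self]
        · rwa [hq, Equiv.swap_apply_self]
      · push Not at hx
        have hkp : k = p := by
          rcases List.mem_append.1 hk with h | h
          · exact absurd hka (hx k h)
          · simpa using h
        subst hkp
        refine ⟨k, k + 1, by omega, ?_, ?_⟩
        · rw [hq, Equiv.swap_apply_right, wordPerm_lt_iff hx]; omega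
        · rw [hq, Equiv.swap_apply_left, ← not_lt, wordPerm_lt_iff hx]; omega
  by_contra hc
  push Not at hc
  obtain ⟨i, j, hij, hj, hi⟩ := key w h hc
  rw [hw] at hj
  rw [← not_lt, hw] at hi
  omega

/-- Among the entries that the letters can touch, `T` is the largest, and an ascending letter moves
the larger of its two entries to the left. -/
theorem Ascending.passable {T : ℕ} {w : List ℕ} (h : Ascending w) (hw : ∀ p ∈ w, p < T) :
    Passable T T w := by
  have key : ∀ (y x : List ℕ) (q : ℕ), w = x ++ y → wordPerm x q = T → Passable T q y := by
    intro y
    induction y with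
    | nil => intros; trivial
    | cons p y ih =>
      intro x q e hq
      have hp : p < T := hw p (by simp [e])
      have hx : ∀ p ∈ x, p + 1 < T + 1 := fun i hi => by
        have := hw i (by simp [e, hi])
        omega
      have hpq : p ≠ q := by
        rintro rfl
        have h1 := h x p y e
        have h2 := wordPerm_lt hx (x := p + 1) (by omega)
        omega
      refine ⟨hp, hpq, ih (x ++ [p]) _ (by simp [e]) ?_⟩
      rw [wordPerm_append, wordPerm_cons, wordPerm_nil, mul_one, Equiv.Perm.mul_apply, ← hq]
      congr 1
      rw [step, swap_apply_nat]
      split_ifs <;> omega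
  exact key w [] T rfl rfl

/-! ### Reduced words -/

/-- `π` as a function on the natural numbers that fixes all numbers that are at least `n`. -/
def onNat {n : ℕ} (π : Equiv.Perm (Fin n)) (x : ℕ) : ℕ := if h : x < n then π ⟨x, h⟩ else x

theorem onNat_of_lt {n : ℕ} (π : Equiv.Perm (Fin n)) {x : ℕ} (h : x < n) :
    onNat π x = π ⟨x, h⟩ := dif_pos h

theorem onNat_fin {n : ℕ} (π : Equiv.Perm (Fin n)) (x : Fin n) : onNat π x = π x :=
  onNat_of_lt π x.2

theorem onNat_lt {n : ℕ} (π : Equiv.Perm (Fin n)) {x : ℕ} (h : x < n) : onNat π x < n := by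
  rw [onNat_of_lt π h]; exact Fin.is_lt _

/-- Working in `Equiv.Perm ℕ` allows words of permutations of different sizes, and their shifts, to
be compared without casts. -/
theorem isWord_iff {n : ℕ} {π : Equiv.Perm (Fin n)} {w : List ℕ} :
    IsWord π w ↔ (∀ p ∈ w, p + 1 < n) ∧ ∀ x, wordPerm w x = onNat π x := by
  have key : ∀ w : List ℕ, (∀ p ∈ w, p + 1 < n) → ∀ x : Fin n,
      (((w.map (simpleReflection n)).prod x : Fin n) : ℕ) = wordPerm w x := by
    intro w hw x
    induction w with
    | nil => rfl
    | cons p w ih =>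
      simp only [List.mem_cons, forall_eq_or_imp] at hw
      rw [List.map_cons, List.prod_cons, Equiv.Perm.mul_apply, wordPerm_cons,
        Equiv.Perm.mul_apply, ← ih hw.2, simpleReflection, dif_pos hw.1, swap_apply_nat,
        Equiv.swap_apply_def]
      simp only [Fin.ext_iff]
      split_ifs <;> rfl
  refine and_congr_right fun hw => ⟨?_, fun h => ?_⟩
  · rintro rfl x
    by_cases hx : x < n
    · rw [onNat_of_lt _ hx, key w hw]
    · rw [onNat, dif_neg hx, wordPerm_of_le hw (not_lt.1 hx)]
  · ext x
    rw [key w hw, h, onNat_fin]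

/-- A letter that undid an inversion could be dropped together with an earlier letter, by the
exchange condition. -/
theorem IsReducedWord.ascending {n : ℕ} {π : Equiv.Perm (Fin n)} {w : List ℕ}
    (h : IsReducedWord π w) : Ascending w := by
  obtain ⟨hw, hm⟩ := h
  rw [isWord_iff] at hw
  rintro x p y rfl
  by_contra hc
  have hne : wordPerm x p ≠ wordPerm x (p + 1) := fun e => by
    have := (wordPerm x).injective e
    omega
  obtain ⟨z, hz, hzx, he⟩ := exists_wordPerm_mul_swap (x := x) (p := p) (by omega)
  have := hm (z ++ y) (isWord_iff.2 ⟨?_, ?_⟩)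
  · simp at this; omega
  · intro i hi
    rcases List.mem_append.1 hi with h | h
    · exact hw.1 i (by simp [hzx i h])
    · exact hw.1 i (by simp [h])
  · intro i
    rw [← hw.2, wordPerm_append, wordPerm_append, he, wordPerm_cons, mul_assoc]

theorem IsWord.rewrites {n b c : ℕ} {π : Equiv.Perm (Fin n)} {u v : List ℕ} (h : IsWord π u)
    (huv : Rewrites b c u v) : IsWord π v := by
  rw [isWord_iff] at *
  exact ⟨fun p hp => h.1 p ((huv.mem_iff p).2 hp), fun x => by rw [← huv.wordPerm_eq, h.2]⟩

theorem IsReducedWord.rewrites {n b c : ℕ} {π : Equiv.Perm (Fin n)} {u v : List ℕ}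
    (h : IsReducedWord π u) (huv : Rewrites b c u v) : IsReducedWord π v :=
  ⟨h.1.rewrites huv, fun w hw => by rw [← huv.length_eq]; exact h.2 w hw⟩

theorem IsWord.exists_isReducedWord {n : ℕ} {π : Equiv.Perm (Fin n)} {w : List ℕ}
    (h : IsWord π w) : ∃ v, IsReducedWord π v := by
  obtain ⟨v, hv, hm⟩ := (measure List.length).wf.has_min {v | IsWord π v} ⟨w, h⟩
  exact ⟨v, hv, fun u hu => not_lt.1 (hm u hu)⟩

theorem IsReducedWord.length_eq {n : ℕ} {π : Equiv.Perm (Fin n)} {w : List ℕ}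
    (h : IsReducedWord π w) : length π = w.length := by
  refine le_antisymm (Nat.sInf_le ⟨w, h.1, rfl⟩) ?_
  obtain ⟨v, hv, he⟩ := Nat.sInf_mem (s := {k | ∃ w, IsWord π w ∧ w.length = k}) ⟨_, w, h.1, rfl⟩
  rw [length, ← he]
  exact h.2 v hv

/-- The truncated `n - 2` does no harm: if `n < 2`, no letter is available and the length is zero.
-/
theorem IsReducedWord.cast_sub_two_mul_length {n : ℕ} {π : Equiv.Perm (Fin n)} {w : List ℕ}
    (h : IsReducedWord π w) : (((n - 2 : ℕ) * length π : ℕ) : ℤ) = ((n : ℤ) - 2) * length π := by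
  rw [h.length_eq]
  cases hw : w with
  | nil => simp
  | cons p w =>
    have := h.1.1 p (by simp [hw])
    rw [Nat.cast_mul, Nat.cast_sub (by omega)]
    rfl

/-! ### Words of a decomposed permutation -/

/-- `π = 12[π', 21[1, π'']]`, in terms of the entries of the permutations. -/
structure Decomposes {n a r : ℕ} (π : Equiv.Perm (Fin n)) (π' : Equiv.Perm (Fin a))
    (π'' : Equiv.Perm (Fin r)) : Prop where
  size : n = a + r + 1
  left : ∀ i < a, onNat π i = onNat π' i
  top : onNat π a = a + r
  right : ∀ j < r, onNat π (a + 1 + j) = a + onNat π'' j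

/-- The word that consists of a word of `π'`, a shifted word of `π''`, and a descending run. -/
def glue (a r : ℕ) (w' w'' : List ℕ) : List ℕ := w' ++ w''.map (· + a) ++ desc a r

theorem length_glue (a r : ℕ) (w' w'' : List ℕ) :
    (glue a r w' w'').length = w'.length + w''.length + r := by
  simp [glue, length_desc, Nat.add_assoc]

section

variable {n a r : ℕ} {π : Equiv.Perm (Fin n)} {π' : Equiv.Perm (Fin a)}
  {π'' : Equiv.Perm (Fin r)}

theorem wordPerm_glue_left {w' w'' : List ℕ} {i : ℕ} (hi : i < a) :
    wordPerm (glue a r w' w'') i = wordPerm w' i := by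
  rw [glue, wordPerm_append, Equiv.Perm.mul_apply, wordPerm_desc_of_lt r hi, wordPerm_append,
    Equiv.Perm.mul_apply, wordPerm_map_add_of_lt _ hi]

theorem wordPerm_glue_top {w' w'' : List ℕ} (h' : ∀ p ∈ w', p + 1 < a)
    (h'' : ∀ p ∈ w'', p + 1 < r) : wordPerm (glue a r w' w'') a = a + r := by
  rw [glue, wordPerm_append, Equiv.Perm.mul_apply, wordPerm_desc_self, wordPerm_append,
    Equiv.Perm.mul_apply, wordPerm_map_add, wordPerm_of_le h'' le_rfl,
    wordPerm_of_le h' (Nat.le_add_right a r)]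

theorem wordPerm_glue_right {w' w'' : List ℕ} {j : ℕ} (h' : ∀ p ∈ w', p + 1 < a)
    (hj : j < r) : wordPerm (glue a r w' w'') (a + 1 + j) = a + wordPerm w'' j := by
  rw [glue, wordPerm_append, Equiv.Perm.mul_apply, wordPerm_desc_add, if_pos hj, wordPerm_append,
    Equiv.Perm.mul_apply, wordPerm_map_add, wordPerm_of_le h' (Nat.le_add_right a _)]

/-- One direction extracts words of the parts from a word of `π`; the other turns a shorter word of
a part into a shorter word of `π`, which transfers minimality. -/
theorem Decomposes.isWord_glue_iff (h : Decomposes π π' π'') {w' w'' : List ℕ}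
    (h' : ∀ p ∈ w', p + 1 < a) (h'' : ∀ p ∈ w'', p + 1 < r) :
    IsWord π (glue a r w' w'') ↔ IsWord π' w' ∧ IsWord π'' w'' := by
  obtain ⟨hn, h1, h2, h3⟩ := h
  have hl : ∀ p ∈ glue a r w' w'', p + 1 < n := by
    intro p hp
    simp only [glue, List.mem_append, List.mem_map, mem_desc] at hp
    rcases hp with (hp | ⟨k, hk, rfl⟩) | hp
    · have := h' p hp; omega
    · have := h'' k hk; omega
    · omega
  rw [isWord_iff, isWord_iff, isWord_iff]
  refine ⟨fun ⟨_, hx⟩ => ⟨⟨h', fun x => ?_⟩, ⟨h'', fun x => ?_⟩⟩, fun ⟨⟨_, hx'⟩, ⟨_, hx''⟩⟩ =>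
    ⟨hl, fun x => ?_⟩⟩
  · by_cases hxa : x < a
    · rw [← h1 x hxa, ← hx, wordPerm_glue_left hxa]
    · rw [onNat, dif_neg hxa, wordPerm_of_le h' (not_lt.1 hxa)]
  · by_cases hxr : x < r
    · have := h3 x hxr
      rw [← hx, wordPerm_glue_right h' hxr] at this
      omega
    · rw [onNat, dif_neg hxr, wordPerm_of_le h'' (not_lt.1 hxr)]
  · by_cases hxn : x < n
    · rcases lt_trichotomy x a with hxa | rfl | hxa
      · rw [wordPerm_glue_left hxa, h1 x hxa, hx']
      · rw [wordPerm_glue_top h' h'', h2]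
      · obtain ⟨j, rfl⟩ : ∃ j, x = a + 1 + j := ⟨x - (a + 1), by omega⟩
        rw [wordPerm_glue_right h' (by omega), h3 j (by omega), hx'']
    · rw [onNat, dif_neg hxn, wordPerm_of_le hl (not_lt.1 hxn)]

/-- The word of `π'` in a reduced word of `π`. -/
def leftPart (a r : ℕ) (v : List ℕ) : List ℕ := small a (del (a + r) v)

/-- The word of `π''` in a reduced word of `π`. -/
def rightPart (a r : ℕ) (v : List ℕ) : List ℕ := big a (del (a + r) v)

theorem Decomposes.of_isReducedWord (h : Decomposes π π' π'') {v : List ℕ}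
    (hv : IsReducedWord π v) :
    Passable (a + r) (a + r) v ∧ dest (a + r) v = a ∧ (∀ p ∈ del (a + r) v, p + 1 ≠ a) ∧
      IsReducedWord π' (leftPart a r v) ∧ IsReducedWord π'' (rightPart a r v) := by
  obtain ⟨hvl, hvx⟩ := isWord_iff.1 hv.1
  have hn := h.size
  have hp : Passable (a + r) (a + r) v := hv.ascending.passable fun p hp => by
    have := hvl p hp; omega
  have hd : dest (a + r) v = a := by
    apply (wordPerm v).injective
    rw [wordPerm_dest hp, hvx, h.top]
  obtain ⟨b₁, c₁, hr, -⟩ := exists_rewrites_del hp le_rfl hd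
  have e : a + r - a = r := by omega
  rw [Nat.sub_self, e] at hr
  set w := del (a + r) v with hw
  have hwT : ∀ p ∈ w, p + 1 < a + r := del_lt hp le_rfl
  have hR := hv.rewrites hr
  have hRx := (isWord_iff.1 hR.1).2
  -- Without the final run, which takes the largest entry to position `a`, the entries of `π'` fill
  -- the first `a` positions and those of `π''` follow, so the set of numbers below `a` is
  -- preserved.
  have hwa : ∀ p ∈ w, p + 1 ≠ a := by
    refine hR.ascending.of_append.not_mem fun x => ?_
    by_cases hx : x < a
    · have h1 := hRx x
      rw [wordPerm_append, Equiv.Perm.mul_apply, wordPerm_desc_of_lt r hx, h.left x hx] at h1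
      rw [h1]
      simp [hx, onNat_lt]
    · obtain ⟨j, rfl⟩ : ∃ j, x = a + j := ⟨x - a, by omega⟩
      by_cases hj : j < r
      · have h1 := hRx (a + 1 + j)
        rw [wordPerm_append, Equiv.Perm.mul_apply, wordPerm_desc_add, if_pos hj,
          h.right j hj] at h1
        rw [h1]
        omega
      · rw [wordPerm_of_le hwT (by omega)]
  obtain ⟨c₂, -, hs, -⟩ := exists_rewrites_shuffle hwa
  have hG : IsReducedWord π (glue a r (leftPart a r v) (rightPart a r v)) :=
    hR.rewrites (hs.append_right _)
  have hl' : ∀ p ∈ leftPart a r v, p + 1 < a := by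
    intro p hp
    simp only [leftPart, small, List.mem_filter, decide_eq_true_eq] at hp
    have := hwa p hp.1
    omega
  have hl'' : ∀ p ∈ rightPart a r v, p + 1 < r := by
    intro p hp
    simp only [rightPart, big, List.mem_map, List.mem_filter, decide_eq_true_eq] at hp
    obtain ⟨k, ⟨hk, hka⟩, rfl⟩ := hp
    have := hwT k hk
    omega
  obtain ⟨hw', hw''⟩ := (h.isWord_glue_iff hl' hl'').1 hG.1
  refine ⟨hp, hd, hwa, ⟨hw', fun z hz => ?_⟩, ⟨hw'', fun z hz => ?_⟩⟩
  · have := hG.2 _ ((h.isWord_glue_iff hz.1 hl'').2 ⟨hz, hw''⟩)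
    simp only [length_glue] at this
    omega
  · have := hG.2 _ ((h.isWord_glue_iff hl' hz.1).2 ⟨hw', hz⟩)
    simp only [length_glue] at this
    omega

theorem Decomposes.exists_rewrites (h : Decomposes π π' π'') {v : List ℕ}
    (hv : IsReducedWord π v) :
    ∃ b₁ c₁ b₂ c₂, Rewrites b₁ c₁ v (glue a r (leftPart a r v) (rightPart a r v)) ∧
      Rewrites b₂ c₂ v
        (desc a r ++ ((rightPart a r v).map (· + (a + 1)) ++ leftPart a r v)) ∧
      b₁ + b₂ = length π'' ∧
      c₁ + c₂ = r * length π' + (r - 2) * length π'' + length π' * length π'' := by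
  obtain ⟨hp, hd, hwa, hl', hl''⟩ := h.of_isReducedWord hv
  obtain ⟨b₁, c₁, hr, hs⟩ := exists_rewrites_del hp le_rfl hd
  obtain ⟨b₂, c₂, hr₂, hb, hc⟩ := hs hwa
  obtain ⟨e₁, e₂, h₁, h₂, he⟩ := exists_rewrites_shuffle hwa
  have e : a + r - a = r := by omega
  rw [Nat.sub_self, e] at hr
  rw [e] at hr₂ hc
  rw [← length_small, ← length_big] at hc
  rw [← length_big] at hb
  -- With the strand in front, the letters of `π''` are one higher than after its deletion, so the
  -- shuffle is carried out on relabelled letters.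
  have hm := h₂.map_of_comm (f := fun p => if p < a then p else p + 1)
    (fun j k hjk => by split_ifs <;> omega) rfl
  have em : ((big a (del (a + r) v)).map (· + a) ++ small a (del (a + r) v)).map
      (fun p => if p < a then p else p + 1) =
        (rightPart a r v).map (· + (a + 1)) ++ leftPart a r v := by
    rw [List.map_append, List.map_map]
    congr 1
    · refine List.map_congr_left fun p _ => ?_
      simp [Nat.add_assoc]
    · conv_rhs => rw [← List.map_id (leftPart a r v)]
      refine List.map_congr_left fun p hp => ?_
      have := hl'.1.1 p hp
      simp only [id]
      rw [if_pos (by omega)]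
  rw [em] at hm
  have f₁ := hr.trans (h₁.append_right (desc a r))
  have f₂ := hr₂.trans (hm.append_left (desc a r))
  rw [Nat.add_zero] at f₁ f₂
  refine ⟨_, _, _, _, f₁, f₂, ?_, ?_⟩
  · rw [hb, hl''.length_eq]; rfl
  · rw [hl'.length_eq, hl''.length_eq]
    unfold leftPart rightPart
    rw [← he, ← hc]
    omega

theorem Decomposes.length_eq (h : Decomposes π π' π'') {v : List ℕ} (hv : IsReducedWord π v) :
    v.length = length π' + length π'' + r := by
  obtain ⟨-, -, -, hl', hl''⟩ := h.of_isReducedWord hv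
  obtain ⟨_, _, _, _, hr, -⟩ := h.exists_rewrites hv
  rw [hr.length_eq, length_glue, hl'.length_eq, hl''.length_eq]

/-- All reduced words of `π` have the same length in terms of the parts, and a glued word attains
it. -/
theorem Decomposes.isReducedWord_glue (h : Decomposes π π' π'') {w' w'' : List ℕ}
    (h' : IsReducedWord π' w') (h'' : IsReducedWord π'' w'') :
    IsReducedWord π (glue a r w' w'') := by
  have hw := (h.isWord_glue_iff h'.1.1 h''.1.1).2 ⟨h'.1, h''.1⟩
  obtain ⟨v, hv⟩ := hw.exists_isReducedWord
  refine ⟨hw, fun z hz => ?_⟩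
  rw [length_glue, ← h'.length_eq, ← h''.length_eq, ← h.length_eq hv]
  exact hv.2 z hz

end

/-! ### The deletion of the strand of the largest entry in explicit words -/

theorem del_desc (T a k : ℕ) :
    del (a + k) (desc a k) = [] ∧ dest (a + k) (desc a k) = a ∧ cost T (a + k) (desc a k) = 0 := by
  induction k with
  | zero => exact ⟨rfl, rfl, rfl⟩
  | succ k ih =>
    have e : step (a + (k + 1)) (a + k) = a + k := if_pos rfl
    have e' : a + k + 1 = a + (k + 1) := rfl
    simp only [desc, del, dest, cost, e, e', ih, if_true]
    simp

theorem del_of_lt (T : ℕ) {q : ℕ} {w : List ℕ} (h : ∀ p ∈ w, p + 1 < q) :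
    del q w = w ∧ dest q w = q ∧ cost T q w = ((T : ℤ) - q) * w.length := by
  induction w with
  | nil => simp [del, dest, cost]
  | cons p w ih =>
    simp only [List.mem_cons, forall_eq_or_imp] at h
    obtain ⟨h1, h2, h3⟩ := ih h.2
    have e : p + 1 ≠ q := by omega
    have e' : p < q := by omega
    have e'' : step q p = q := if_neg e
    simp only [del, dest, cost, e, e', e'', h1, h2, h3, if_true, if_false, List.length_cons]
    refine ⟨rfl, trivial, ?_⟩
    push_cast; ring

theorem del_map_add (T q : ℕ) (w : List ℕ) :
    del q (w.map (· + (q + 1))) = w.map (· + q) ∧ dest q (w.map (· + (q + 1))) = q ∧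
      cost T q (w.map (· + (q + 1))) = ((T : ℤ) - q - 2) * w.length := by
  induction w with
  | nil => simp [del, dest, cost]
  | cons p w ih =>
    obtain ⟨h1, h2, h3⟩ := ih
    have e : p + (q + 1) + 1 ≠ q := by omega
    have e' : ¬ p + (q + 1) < q := by omega
    have e'' : step q (p + (q + 1)) = q := if_neg e
    simp only [List.map_cons, del, dest, cost, e, e', e'', h1, h2, h3, if_false, List.length_cons]
    refine ⟨rfl, trivial, ?_⟩
    push_cast; ring

/-! ### Opposite reduced words -/

/-- There are two reduced words of `π` such that the paths from any reduced word to these two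
have in total `b` long braid moves and `c` commutation moves, and every path between the two
has at least `b` long braid moves and `c` commutation moves. The last fact is witnessed by the
sum of the letters and by a function that is unchanged by long braid moves. -/
def OppositeWords {n : ℕ} (π : Equiv.Perm (Fin n)) (b c : ℕ) : Prop :=
  ∃ u v : List ℕ, IsReducedWord π u ∧ IsReducedWord π v ∧
    (∀ w, IsReducedWord π w → ∃ b₁ c₁ b₂ c₂, Rewrites b₁ c₁ w u ∧ Rewrites b₂ c₂ w v ∧
      b₁ + b₂ = b ∧ c₁ + c₂ = c) ∧
    v.sum = u.sum + b ∧
    ∃ s : List ℕ → ℤ,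
      (∀ x y, IsReducedWord π x → IsReducedWord π y → CommutationMove x y → |s x - s y| ≤ 1) ∧
      (∀ x y, IsReducedWord π x → IsReducedWord π y → LongBraidMove x y → s x = s y) ∧
      s v = s u + c

theorem OppositeWords.of_size_zero (π : Equiv.Perm (Fin 0)) : OppositeWords π 0 0 := by
  have hr : IsReducedWord π [] := ⟨⟨by simp, Subsingleton.elim _ _⟩, by simp⟩
  refine ⟨[], [], hr, hr, fun w hw => ?_, rfl, 0, by simp, by simp, by simp⟩
  have : w = [] := List.length_eq_zero_iff.1 (Nat.le_zero.1 (hw.2 [] hr.1))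
  subst this
  exact ⟨0, 0, 0, 0, .refl _, .refl _, rfl, rfl⟩

theorem sum_map_add (a : ℕ) (w : List ℕ) : (w.map (· + a)).sum = w.sum + a * w.length := by
  induction w with
  | nil => rfl
  | cons p w ih => simp only [List.map_cons, List.sum_cons, ih, List.length_cons]; ring

theorem OppositeWords.of_decomposes {n a r b' c' b'' c'' : ℕ} {π : Equiv.Perm (Fin n)}
    {π' : Equiv.Perm (Fin a)} {π'' : Equiv.Perm (Fin r)} (h : Decomposes π π' π'')
    (h' : OppositeWords π' b' c') (h'' : OppositeWords π'' b'' c'') :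
    OppositeWords π (b' + b'' + length π'')
      (c' + c'' + (r * length π' + (r - 2) * length π'' + length π' * length π'')) := by
  obtain ⟨u', v', hu', hv', hw', hs', s', hc', hb', ht'⟩ := h'
  obtain ⟨u'', v'', hu'', hv'', hw'', hs'', s'', hc'', hb'', ht''⟩ := h''
  have hu := h.isReducedWord_glue hu' hu''
  have key : ∀ w, IsReducedWord π w → ∃ b₁ c₁ b₂ c₂, Rewrites b₁ c₁ w (glue a r u' u'') ∧
      Rewrites b₂ c₂ w (desc a r ++ (v''.map (· + (a + 1)) ++ v')) ∧
      b₁ + b₂ = b' + b'' + length π'' ∧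
      c₁ + c₂ =
        c' + c'' + (r * length π' + (r - 2) * length π'' + length π' * length π'') := by
    intro w hw
    obtain ⟨-, -, -, hl', hl''⟩ := h.of_isReducedWord hw
    obtain ⟨b₁, c₁, b₂, c₂, hr₁, hr₂, hb, hc⟩ := h.exists_rewrites hw
    obtain ⟨b₁', c₁', b₂', c₂', hr₁', hr₂', hb', hc'⟩ := hw' _ hl'
    obtain ⟨b₁'', c₁'', b₂'', c₂'', hr₁'', hr₂'', hb'', hc''⟩ := hw'' _ hl''
    have f₁ := (hr₁.trans ((hr₁'.append_right _).append_right _)).trans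
      (((hr₁''.map_add a).append_left u').append_right (desc a r))
    have f₂ := (hr₂.trans (((hr₂''.map_add (a + 1)).append_right _).append_left _)).trans
      ((hr₂'.append_left (v''.map (· + (a + 1)))).append_left (desc a r))
    exact ⟨_, _, _, _, f₁, f₂, by omega, by omega⟩
  -- The second end is reduced because moves lead to it from the first.
  have hv : IsReducedWord π (desc a r ++ (v''.map (· + (a + 1)) ++ v')) := by
    obtain ⟨_, _, _, _, _, hr, _⟩ := key _ hu
    exact hu.rewrites hr
  refine ⟨_, _, hu, hv, key, ?_, ?_⟩
  -- The letters of `π''` are shifted by `a + 1` in one word and by `a` in the other; this gives the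
  -- extra `length π''`.
  · simp only [glue, List.sum_append, sum_map_add, hs', hs'', hv''.length_eq]
    rw [← hv''.length_eq, ← hu''.length_eq]
    ring
  -- The potential adds the cost of passing the strand, the number of mixed pairs in the wrong order
  -- for the first end, and the potentials of the two parts. A commutation move affects at most one
  -- of the four terms.
  · refine ⟨fun w => cost (a + r : ℕ) (a + r) w + mixed a (del (a + r) w) +
      s' (leftPart a r w) + s'' (rightPart a r w), ?_, ?_, ?_⟩
    · intro x y hx hy hxy
      obtain ⟨hpx, -, -, hlx', hlx''⟩ := h.of_isReducedWord hx
      obtain ⟨hpy, -, -, hly', hly''⟩ := h.of_isReducedWord hy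
      rcases hxy.del hpx hpy with ⟨he, hc⟩ | ⟨hm, hc⟩
      · simpa [leftPart, rightPart, he] using hc
      · rcases hm.shuffle (a := a) with ⟨h1, h2, h3⟩ | ⟨h1, h2, h3⟩ | ⟨h1, h2, h3⟩
        · have := hc' _ _ hlx' hly' h1
          simp only [rightPart, h2, h3, hc]
          rw [abs_le] at this ⊢
          constructor <;> linarith [this.1, this.2]
        · have := hc'' _ _ hlx'' hly'' h2
          simp only [leftPart, h1, h3, hc]
          rw [abs_le] at this ⊢
          constructor <;> linarith [this.1, this.2]
        · simp only [leftPart, rightPart, h1, h2, hc]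
          rw [abs_le] at h3 ⊢
          constructor <;> linarith [h3.1, h3.2]
    · intro x y hx hy hxy
      obtain ⟨hpx, -, hax, hlx', hlx''⟩ := h.of_isReducedWord hx
      obtain ⟨hpy, -, -, hly', hly''⟩ := h.of_isReducedWord hy
      obtain ⟨he | hm, hc⟩ := hxy.del hpx hpy
      · simp only [leftPart, rightPart, he, hc]
      · obtain ⟨⟨h1, h2⟩ | ⟨h1, h2⟩, h3⟩ := hm.shuffle hax
        · have := hb' _ _ hlx' hly' h1
          simp only [rightPart, h2, h3, hc, this]
        · have := hb'' _ _ hlx'' hly'' h2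
          simp only [leftPart, h1, h3, hc, this]
    · have hgu : ∀ p ∈ u' ++ u''.map (· + a), p + 1 < a + r := by
        intro p hp
        rcases List.mem_append.1 hp with hp | hp
        · have := hu'.1.1 p hp; omega
        · obtain ⟨k, hk, rfl⟩ := List.mem_map.1 hp
          have := hu''.1.1 k hk
          omega
      have hu'a : ∀ p ∈ u', p < a := fun p hp => by have := hu'.1.1 p hp; omega
      have hv'a : ∀ p ∈ v', p < a := fun p hp => by have := hv'.1.1 p hp; omega
      obtain ⟨d1, d2, d3⟩ := del_desc (a + r) a r
      obtain ⟨e1, e2, e3⟩ := del_of_lt (a + r) hgu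
      obtain ⟨f1, f2, f3⟩ := del_of_lt (a + r) hv'.1.1
      obtain ⟨g1, g2, g3⟩ := del_map_add (a + r) a v''
      -- At the first end the cost and the mixed count vanish. At the second they are `r * length π'
      -- + (r - 2) * length π''` and `length π' * length π''`.
      have hr := hv''.cast_sub_two_mul_length
      simp only [leftPart, rightPart, glue, del_append, cost_append, d1, d2, d3, e1, e2,
        e3, f1, f3, g1, g2, g3, List.nil_append, List.append_nil, small_append, big_append,
        mixed_append, small_of_lt hu'a, big_of_lt hu'a, mixed_of_lt hu'a, small_of_lt hv'a,
        big_of_lt hv'a, mixed_of_lt hv'a, small_map_add, big_map_add, mixed_map_add, ht', ht'',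
        ← hv'.length_eq, ← hv''.length_eq]
      simp only [Nat.cast_add, hr]
      simp only [List.length_nil]
      push_cast
      ring

/-! ### Diameters -/

theorem abs_sub_le_walk_length {V : Type*} {H : SimpleGraph V} {f : V → ℤ}
    (hf : ∀ x y, H.Adj x y → |f x - f y| ≤ 1) {x y : V} (p : H.Walk x y) :
    |f x - f y| ≤ p.length := by
  induction p with
  | nil => simp
  | @cons x y z h p ih =>
    rw [SimpleGraph.Walk.length_cons]
    push_cast
    linarith [abs_sub_le (f x) (f y) (f z), hf _ _ h, ih]

/-- The distance bound makes the extended diameter finite, which gives connectedness; the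
1-Lipschitz function `f` forces the pair `x`, `y` to be `D` apart. -/
theorem connected_and_diam_eq {V : Type*} {H : SimpleGraph V} {D : ℕ}
    (hD : ∀ x y, H.edist x y ≤ D) {f : V → ℤ} (hf : ∀ x y, H.Adj x y → |f x - f y| ≤ 1)
    {x y : V} (hxy : f y = f x + D) : H.Connected ∧ H.diam = D := by
  have hle : H.ediam ≤ D := SimpleGraph.ediam_le_of_edist_le hD
  have hne : H.ediam ≠ ⊤ := (hle.trans_lt (ENat.natCast_lt_top D)).ne
  have : Nonempty V := ⟨x⟩
  have hc := SimpleGraph.connected_of_ediam_ne_top hne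
  refine ⟨hc, ?_⟩
  obtain ⟨p, hp⟩ := hc.exists_walk_length_eq_edist x y
  have hp' := abs_sub_le_walk_length hf p
  have hDp : D ≤ p.length := by
    rw [hxy, abs_le] at hp'
    have := hp'.1
    omega
  have he : H.ediam = D := le_antisymm hle <|
    (Nat.cast_le.2 hDp).trans (hp.le.trans SimpleGraph.edist_le_ediam)
  rw [SimpleGraph.diam, he, ENat.toNat_natCast]

section

variable {n : ℕ} {π : Equiv.Perm (Fin n)} {V : Type*} {H : SimpleGraph V}
  {φ : ReducedWord π → V} {α β : ℕ}

/-- The weights `α` and `β` bound what a braid and a commutation cost in `H`. The pairs `(1, 1)`,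
`(1, 0)`, `(0, 1)` treat `G`, `C`, `B` uniformly. -/
theorem Rewrites.edist_le (hα : ∀ u v, LongBraidMove u.1 v.1 → H.edist (φ u) (φ v) ≤ α)
    (hβ : ∀ u v, CommutationMove u.1 v.1 → H.edist (φ u) (φ v) ≤ β) {b c : ℕ} {u v : List ℕ}
    (h : Rewrites b c u v) (hu : IsReducedWord π u) (hv : IsReducedWord π v) :
    H.edist (φ ⟨u, hu⟩) (φ ⟨v, hv⟩) ≤ (α * b + β * c : ℕ) := by
  induction h with
  | refl => simp
  | @comm b c u v w hm _ ih =>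
    have hv' := hu.rewrites (.of_comm hm)
    refine SimpleGraph.edist_triangle.trans
      ((add_le_add (hβ ⟨u, hu⟩ ⟨v, hv'⟩ hm) (ih hv' hv)).trans (le_of_eq ?_))
    push_cast; ring
  | @braid b c u v w hm _ ih =>
    have hv' := hu.rewrites (.of_braid hm)
    refine SimpleGraph.edist_triangle.trans
      ((add_le_add (hα ⟨u, hu⟩ ⟨v, hv'⟩ hm) (ih hv' hv)).trans (le_of_eq ?_))
    push_cast; ring

theorem connected_and_diam_eq_of_rewrites (hφ : Function.Surjective φ)
    (hα : ∀ u v, LongBraidMove u.1 v.1 → H.edist (φ u) (φ v) ≤ α)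
    (hβ : ∀ u v, CommutationMove u.1 v.1 → H.edist (φ u) (φ v) ≤ β) {b c : ℕ} {u v : List ℕ}
    (hu : IsReducedWord π u) (hv : IsReducedWord π v)
    (hw : ∀ w, IsReducedWord π w → ∃ b₁ c₁ b₂ c₂, Rewrites b₁ c₁ w u ∧ Rewrites b₂ c₂ w v ∧
      b₁ + b₂ = b ∧ c₁ + c₂ = c)
    {f : V → ℤ} (hf : ∀ x y, H.Adj x y → |f x - f y| ≤ 1)
    (huv : f (φ ⟨v, hv⟩) = f (φ ⟨u, hu⟩) + (α * b + β * c : ℕ)) :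
    H.Connected ∧ H.diam = α * b + β * c := by
  refine connected_and_diam_eq (fun x y => ?_) hf huv
  obtain ⟨⟨x, hx⟩, rfl⟩ := hφ x
  obtain ⟨⟨y, hy⟩, rfl⟩ := hφ y
  obtain ⟨b₁, c₁, b₂, c₂, h₁, h₂, rfl, rfl⟩ := hw x hx
  obtain ⟨b₁', c₁', b₂', c₂', h₁', h₂', hb, hc⟩ := hw y hy
  have k₁ := (h₁.trans h₁'.symm).edist_le hα hβ hx hy
  have k₂ := (h₂.trans h₂'.symm).edist_le hα hβ hx hy
  -- The bounds for the routes through `u` and through `v` add up to twice the claimed diameter, so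
  -- the smaller one suffices.
  have e : (α * (b₁ + b₁') + β * (c₁ + c₁')) + (α * (b₂ + b₂') + β * (c₂ + c₂')) =
      (α * (b₁ + b₂) + β * (c₁ + c₂)) + (α * (b₁' + b₂') + β * (c₁' + c₂')) := by ring
  rw [hb, hc] at e
  rcases le_total (α * (b₁ + b₁') + β * (c₁ + c₁')) (α * (b₂ + b₂') + β * (c₂ + c₂')) with hle | hle
  · exact k₁.trans (Nat.cast_le.2 (by omega))
  · exact k₂.trans (Nat.cast_le.2 (by omega))

end

theorem CommutationMove.sum_eq {u v : List ℕ} (h : CommutationMove u v) : u.sum = v.sum := by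
  obtain ⟨x, y, j, k, -, rfl, rfl⟩ := h
  simp only [List.sum_append, List.sum_cons, List.sum_nil]
  ring

theorem LongBraidMove.abs_sum_sub_le {u v : List ℕ} (h : LongBraidMove u v) :
    |(u.sum : ℤ) - v.sum| ≤ 1 := by
  obtain ⟨x, y, j, ⟨rfl, rfl⟩ | ⟨rfl, rfl⟩⟩ := h <;>
    (simp only [List.sum_append, List.sum_cons, List.sum_nil]; push_cast; ring_nf; simp)

theorem edist_le_one_of_adj {V : Type*} {H : SimpleGraph V} {x y : V} (h : x ≠ y → H.Adj x y) :
    H.edist x y ≤ 1 :=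
  SimpleGraph.edist_le_one_iff_adj_or_eq.2 ((em (x = y)).symm.imp_left h)

theorem edist_eq_zero_of_eq {V : Type*} {H : SimpleGraph V} {x y : V} (h : x = y) :
    H.edist x y = (0 : ℕ) := by
  simp [h]

theorem OppositeWords.connected_and_diam_eq {n b c : ℕ} {π : Equiv.Perm (Fin n)}
    (h : OppositeWords π b c) :
    ((G π).Connected ∧ (G π).diam = b + c) ∧ ((C π).Connected ∧ (C π).diam = b) ∧
      ((B π).Connected ∧ (B π).diam = c) := by
  obtain ⟨u, v, hu, hv, hw, hs, s, hc, hb, ht⟩ := h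
  refine ⟨?_, ?_, ?_⟩
  · have key := connected_and_diam_eq_of_rewrites (H := G π) (φ := id) (α := 1) (β := 1)
      Function.surjective_id
      (fun x y hm => edist_le_one_of_adj fun hne => ⟨hne, by tauto⟩)
      (fun x y hm => edist_le_one_of_adj fun hne => ⟨hne, by tauto⟩) hu hv hw
      (f := fun w => (w.1.sum : ℤ) + s w.1) ?_ ?_
    · simpa using key
    · have h1 : ∀ x y : ReducedWord π, CommutationMove x.1 y.1 →
          |((x.1.sum : ℤ) + s x.1) - (y.1.sum + s y.1)| ≤ 1 := by
        intro x y hm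
        rw [hm.sum_eq, add_sub_add_left_eq_sub]
        exact hc _ _ x.2 y.2 hm
      have h2 : ∀ x y : ReducedWord π, LongBraidMove x.1 y.1 →
          |((x.1.sum : ℤ) + s x.1) - (y.1.sum + s y.1)| ≤ 1 := by
        intro x y hm
        rw [hb _ _ x.2 y.2 hm, add_sub_add_right_eq_sub]
        exact hm.abs_sum_sub_le
      rintro x y ⟨-, hm | hm | hm | hm⟩
      · exact h1 x y hm
      · rw [abs_sub_comm]; exact h1 y x hm
      · exact h2 x y hm
      · rw [abs_sub_comm]; exact h2 y x hm
    · simp only [id, hs, ht]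
      push_cast; ring
  · have key := connected_and_diam_eq_of_rewrites (H := C π) (φ := Quot.mk _) (α := 1) (β := 0)
      Quot.mk_surjective
      (fun x y hm => edist_le_one_of_adj fun hne => ⟨hne, x, y, rfl, rfl, Or.inl hm⟩)
      (fun x y hm => (edist_eq_zero_of_eq
        (Quot.sound (r := fun u v : ReducedWord π => CommutationMove u.1 v.1) hm)).le) hu hv hw
      (f := Quot.lift (fun w => (w.1.sum : ℤ)) fun x y hm => by rw [hm.sum_eq]) ?_ ?_
    · simpa using key
    · rintro _ _ ⟨-, x, y, rfl, rfl, hm | hm⟩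
      · exact hm.abs_sum_sub_le
      · rw [abs_sub_comm]; exact hm.abs_sum_sub_le
    · simp only [hs]
      push_cast; ring
  · have key := connected_and_diam_eq_of_rewrites (H := B π) (φ := Quot.mk _) (α := 0) (β := 1)
      Quot.mk_surjective
      (fun x y hm => (edist_eq_zero_of_eq
        (Quot.sound (r := fun u v : ReducedWord π => LongBraidMove u.1 v.1) hm)).le)
      (fun x y hm => edist_le_one_of_adj fun hne => ⟨hne, x, y, rfl, rfl, Or.inl hm⟩) hu hv hw
      (f := Quot.lift (fun w => s w.1) fun x y hm => hb _ _ x.2 y.2 hm) ?_ ?_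
    · simpa using key
    · rintro _ _ ⟨-, x, y, rfl, rfl, hm | hm⟩
      · exact hc _ _ x.2 y.2 hm
      · rw [abs_sub_comm]; exact hc _ _ y.2 x.2 hm
    · simp only [ht]
      push_cast; ring

/-! ### Inflations of `12` and `21` -/

theorem sizedPerm_ext {p q : SizedPerm} :
    p = q ↔ p.1 = q.1 ∧ ∀ i < p.1, onNat p.2 i = onNat q.2 i := by
  obtain ⟨n, π⟩ := p
  obtain ⟨m, ρ⟩ := q
  refine ⟨by rintro ⟨⟩; simp, ?_⟩
  rintro ⟨rfl, h⟩
  congr 1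
  ext i
  have := h i i.2
  rwa [onNat_fin, onNat_fin] at this

/-- Block offsets become sums over all of `Fin k`, which `simp` can evaluate for two blocks. -/
theorem sum_castLE {k : ℕ} (f : Fin k → ℕ) (i : Fin k) :
    ∑ l : Fin i, f (Fin.castLE i.2.le l) = ∑ l, if l < i then f l else 0 := by
  refine Finset.sum_of_injOn (Fin.castLE i.2.le) (Fin.castLE_injective _).injOn (by simp) ?_ ?_
  · intro l _ hl
    rw [if_neg]
    intro h
    exact hl ⟨⟨l, h⟩, by simp, rfl⟩
  · intro l _
    rw [if_pos]
    exact l.2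

theorem inflation_apply {k : ℕ} (σ : Equiv.Perm (Fin k)) (p : Fin k → SizedPerm) {i c : Fin k}
    (hi : σ.symm c = i) (j : Fin (p i).1) :
    onNat (inflation σ p).2 ((∑ l, if l < i then (p l).1 else 0) + j) =
      (∑ l, if l < c then (p (σ.symm l)).1 else 0) + (p i).2 j := by
  subst hi
  have e : ((∑ l, if l < σ.symm c then (p l).1 else 0) + j : ℕ) =
      (finSigmaFinEquiv (n := fun i => (p i).1) ⟨σ.symm c, j⟩ : ℕ) := by
    rw [finSigmaFinEquiv_apply, ← sum_castLE]
  have e' : Equiv.sigmaCongrLeft' (β := fun i => Fin (p i).1) σ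
      ⟨σ.symm c, (p (σ.symm c)).2 j⟩ = ⟨c, (p (σ.symm c)).2 j⟩ :=
    (Equiv.symm_apply_eq _).2 rfl
  rw [e, ← sum_castLE (fun l => (p (σ.symm l)).1)]
  refine (onNat_of_lt _ (Fin.is_lt (finSigmaFinEquiv (n := fun i => (p i).1) _))).trans ?_
  simp only [inflation, Fin.eta, Equiv.trans_apply, Equiv.symm_apply_apply,
    Equiv.sigmaCongrRight_apply, finCongr_apply, Fin.val_cast]
  erw [e']
  rw [finSigmaFinEquiv_apply]

theorem inflation_perm12 (p q : SizedPerm) :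
    (inflation perm12 ![p, q]).1 = p.1 + q.1 ∧
      (∀ i < p.1, onNat (inflation perm12 ![p, q]).2 i = onNat p.2 i) ∧
      ∀ i < q.1, onNat (inflation perm12 ![p, q]).2 (p.1 + i) = p.1 + onNat q.2 i := by
  have e0 : perm12.symm 0 = 0 := rfl
  have e1 : perm12.symm 1 = 1 := rfl
  refine ⟨by simp [inflation], fun i hi => ?_, fun i hi => ?_⟩
  · have := inflation_apply perm12 ![p, q] e0 ⟨i, hi⟩
    rw [onNat_of_lt _ hi]
    simp at this
    exact this
  · have := inflation_apply perm12 ![p, q] e1 ⟨i, hi⟩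
    rw [onNat_of_lt _ hi]
    simp [e0] at this
    exact this

theorem inflation_perm21 (p q : SizedPerm) :
    (inflation perm21 ![p, q]).1 = p.1 + q.1 ∧
      (∀ i < p.1, onNat (inflation perm21 ![p, q]).2 i = q.1 + onNat p.2 i) ∧
      ∀ i < q.1, onNat (inflation perm21 ![p, q]).2 (p.1 + i) = onNat q.2 i := by
  have e0 : perm21.symm 0 = 1 := rfl
  have e1 : perm21.symm 1 = 0 := rfl
  refine ⟨by simp [inflation], fun i hi => ?_, fun i hi => ?_⟩
  · have := inflation_apply perm21 ![p, q] e1 ⟨i, hi⟩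
    rw [onNat_of_lt _ hi]
    simp [e0] at this
    exact this
  · have := inflation_apply perm21 ![p, q] e0 ⟨i, hi⟩
    rw [onNat_of_lt _ hi]
    simp at this
    exact this

theorem decomposes_iff {n a r : ℕ} {π : Equiv.Perm (Fin n)} {π' : Equiv.Perm (Fin a)}
    {π'' : Equiv.Perm (Fin r)} :
    Decomposes π π' π'' ↔ (⟨n, π⟩ : SizedPerm) =
      inflation perm12 ![⟨a, π'⟩, inflation perm21 ![single, ⟨r, π''⟩]] := by
  obtain ⟨h1, h2, h3⟩ := inflation_perm21 single ⟨r, π''⟩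
  obtain ⟨k1, k2, k3⟩ := inflation_perm12 ⟨a, π'⟩ (inflation perm21 ![single, ⟨r, π''⟩])
  have hs' : onNat single.2 0 = 0 := rfl
  change _ = 1 + r at h1
  change ∀ i < 1, _ = r + onNat single.2 i at h2
  change ∀ i < r, onNat _ (1 + i) = onNat π'' i at h3
  change _ = a + _ at k1
  change ∀ i < a, _ = onNat π' i at k2
  change ∀ i < _, onNat _ (a + i) = a + _ at k3
  rw [h1] at k1
  have e0 := k3 0 (by omega)
  rw [h2 0 (by omega), hs'] at e0
  have e1 : ∀ j < r, onNat (inflation perm12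
      ![⟨a, π'⟩, inflation perm21 ![single, ⟨r, π''⟩]]).2 (a + 1 + j) = a + onNat π'' j := by
    intro j hj
    rw [Nat.add_assoc, k3 (1 + j) (by omega), h3 j hj]
  rw [sizedPerm_ext]
  constructor
  · rintro ⟨hn, l1, l2, l3⟩
    refine ⟨by simp only; omega, fun i hi => ?_⟩
    simp only at hi ⊢
    rcases lt_trichotomy i a with hia | rfl | hia
    · rw [l1 i hia, k2 i hia]
    · rw [l2]; exact e0.symm
    · obtain ⟨j, rfl⟩ : ∃ j, i = a + 1 + j := ⟨i - (a + 1), by omega⟩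
      rw [l3 j (by omega), e1 j (by omega)]
  · rintro ⟨hn, hx⟩
    simp only at hn hx
    refine ⟨by omega, fun i hi => ?_, ?_, fun j hj => ?_⟩
    · rw [hx i (by omega), k2 i hi]
    · rw [hx a (by omega)]; exact e0
    · rw [hx (a + 1 + j) (by omega), e1 j hj]

/-! ### Avoidance of 231 -/

theorem avoids_perm231_iff {n : ℕ} {π : Equiv.Perm (Fin n)} :
    Avoids π perm231 ↔ ∀ i j k, i < j → j < k → k < n →
      ¬ (onNat π k < onNat π i ∧ onNat π i < onNat π j) := by
  constructor
  · rintro h i j k hij hjk hk ⟨h1, h2⟩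
    rw [onNat_of_lt π (by omega : i < n), onNat_of_lt π hk] at h1
    rw [onNat_of_lt π (by omega : i < n), onNat_of_lt π (by omega : j < n)] at h2
    have hm : StrictMono ![(⟨i, by omega⟩ : Fin n), ⟨j, by omega⟩, ⟨k, hk⟩] := by
      rw [Fin.strictMono_iff_lt_succ]
      intro l
      fin_cases l
      · exact hij
      · exact hjk
    refine h ⟨OrderEmbedding.ofStrictMono _ hm, fun x y => ?_⟩
    simp only [OrderEmbedding.coe_ofStrictMono]
    rw [Fin.le_def]
    fin_cases x <;> fin_cases y <;> simp [perm231, -Fin.val_fin_le] <;> omega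
  · rintro h ⟨f, hf⟩
    have h01 : f 0 < f 1 := f.strictMono (by decide)
    have h12 : f 1 < f 2 := f.strictMono (by decide)
    refine h (f 0) (f 1) (f 2) h01 h12 (f 2).2 ?_
    simp only [onNat_fin]
    exact ⟨lt_of_not_ge fun hc => absurd ((hf 0 2).1 hc) (by decide),
      lt_of_not_ge fun hc => absurd ((hf 1 0).1 hc) (by decide)⟩

theorem onNat_injective {n : ℕ} (π : Equiv.Perm (Fin n)) {x y : ℕ} (hx : x < n) (hy : y < n)
    (h : onNat π x = onNat π y) : x = y := by
  rw [onNat_of_lt π hx, onNat_of_lt π hy] at h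
  simpa using π.injective (Fin.ext h)

theorem exists_perm_onNat_eq {n : ℕ} (f : ℕ → ℕ) (hf : ∀ i < n, f i < n)
    (hinj : ∀ i < n, ∀ j < n, f i = f j → i = j) :
    ∃ σ : Equiv.Perm (Fin n), ∀ i < n, onNat σ i = f i := by
  let g : Fin n → Fin n := fun i => ⟨f i, hf i i.2⟩
  have hg : Function.Injective g := fun i j h =>
    Fin.ext (hinj i i.2 j j.2 (congrArg Fin.val h))
  exact ⟨Equiv.ofBijective g (Finite.injective_iff_bijective.1 hg),
    fun i hi => by rw [onNat_of_lt _ hi]; rfl⟩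

section

variable {n a r : ℕ} {π : Equiv.Perm (Fin n)} {π' : Equiv.Perm (Fin a)}
  {π'' : Equiv.Perm (Fin r)}

theorem Decomposes.avoids (h : Decomposes π π' π'') (hπ : Avoids π perm231) :
    Avoids π' perm231 ∧ Avoids π'' perm231 := by
  have hn := h.size
  simp only [avoids_perm231_iff] at *
  refine ⟨fun i j k hij hjk hk => ?_, fun i j k hij hjk hk => ?_⟩
  · rw [← h.left i (by omega), ← h.left j (by omega), ← h.left k hk]
    exact hπ i j k hij hjk (by omega)
  · have := hπ (a + 1 + i) (a + 1 + j) (a + 1 + k) (by omega) (by omega) (by omega)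
    rw [h.right i (by omega), h.right j (by omega), h.right k hk] at this
    omega

/-- An entry before the largest one and a smaller entry after it would form a 231 with it. Hence
everything on the left is below everything on the right, and counting fixes the ranges of values. -/
theorem exists_decomposes (hn : n = a + r + 1) (hπ : Avoids π perm231)
    (htop : onNat π a = a + r) :
    ∃ (π' : Equiv.Perm (Fin a)) (π'' : Equiv.Perm (Fin r)), Decomposes π π' π'' := by
  rw [avoids_perm231_iff] at hπ
  have hlt : ∀ i < n, i ≠ a → onNat π i < a + r := fun i hi hia => by
    have h1 := onNat_lt π hi
    have h2 : onNat π i ≠ onNat π a := fun e => hia (onNat_injective π hi (by omega) e)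
    omega
  have hlr : ∀ i < a, ∀ j < r, onNat π i < onNat π (a + 1 + j) := fun i hi j hj => by
    have h1 := hπ i a (a + 1 + j) hi (by omega) (by omega)
    have h2 := hlt i (by omega) (by omega)
    have h3 : onNat π i ≠ onNat π (a + 1 + j) := fun e => by
      have := onNat_injective π (by omega) (by omega) e
      omega
    rw [htop] at h1
    omega
  have hleft : ∀ i < a, onNat π i < a := fun i hi => by
    by_contra hc
    -- The `r` entries on the right lie strictly between `onNat π i` and `a + r`, where there is no
    -- room for them if `onNat π i` is at least `a`.
    have hcard := Finset.card_le_card_of_injOn (s := Finset.range r)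
      (t := Finset.Ioo (onNat π i) (a + r)) (fun j => onNat π (a + 1 + j))
      (fun j hj => by
        have hj' : j < r := by simpa using hj
        simpa using ⟨hlr i hi j hj', hlt (a + 1 + j) (by omega) (by omega)⟩)
      (fun x hx y hy e => by
        have hx' : x < r := by simpa using hx
        have hy' : y < r := by simpa using hy
        have := onNat_injective π (by omega) (by omega) e
        omega)
    have := hlt i (by omega) (by omega)
    simp only [Finset.card_range, Nat.card_Ioo] at hcard
    omega
  have hright : ∀ j < r, a ≤ onNat π (a + 1 + j) := fun j hj => by
    have hcard := Finset.card_le_card_of_injOn (s := Finset.range a)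
      (t := Finset.range (onNat π (a + 1 + j))) (fun i => onNat π i)
      (fun i hi => by
        have hi' : i < a := by simpa using hi
        simpa using hlr i hi' j hj)
      (fun x hx y hy e => by
        have hx' : x < a := by simpa using hx
        have hy' : y < a := by simpa using hy
        exact onNat_injective π (by omega) (by omega) e)
    simpa using hcard
  obtain ⟨π', h'⟩ := exists_perm_onNat_eq (n := a) (onNat π) hleft
    fun i hi j hj e => onNat_injective π (by omega) (by omega) e
  obtain ⟨π'', h''⟩ := exists_perm_onNat_eq (n := r) (fun j => onNat π (a + 1 + j) - a)
    (fun j hj => by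
      have := hlt (a + 1 + j) (by omega) (by omega)
      have := hright j hj
      omega)
    (fun i hi j hj e => by
      have h1 := hright i hi
      have h2 := hright j hj
      have := onNat_injective π (x := a + 1 + i) (y := a + 1 + j) (by omega) (by omega) (by omega)
      omega)
  refine ⟨π', π'', hn, fun i hi => (h' i hi).symm, htop, fun j hj => ?_⟩
  have := hright j hj
  rw [h'' j hj]
  omega

end

theorem exists_oppositeWords {n : ℕ} {π : Equiv.Perm (Fin n)} (hπ : Avoids π perm231) :
    ∃ b c, OppositeWords π b c := by
  induction n using Nat.strong_induction_on with
  | _ n ih =>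
    rcases Nat.eq_zero_or_pos n with rfl | hn
    · exact ⟨0, 0, .of_size_zero π⟩
    · obtain ⟨a, ha⟩ := π.surjective ⟨n - 1, by omega⟩
      have htop : onNat π a = a + (n - 1 - a) := by
        rw [onNat_fin, ha]
        have := a.2
        simp only
        omega
      obtain ⟨π', π'', h⟩ := exists_decomposes (r := n - 1 - a) (by omega) hπ htop
      obtain ⟨h', h''⟩ := h.avoids hπ
      obtain ⟨b', c', hb'⟩ := ih _ a.2 h'
      obtain ⟨b'', c'', hb''⟩ := ih _ (by omega) h''
      exact ⟨_, _, .of_decomposes h hb' hb''⟩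

end PermGraph

theorem theorem5p4 (n m : ℕ) (hm : 1 ≤ m) (hmn : m ≤ n) (π : Equiv.Perm (Fin n))
    (hπ : PermGraph.Avoids π PermGraph.perm231)
    (hπm : ((π ⟨m - 1, by omega⟩ : Fin n) : ℕ) + 1 = n) :
    (∃ (π' : Equiv.Perm (Fin (m - 1))) (π'' : Equiv.Perm (Fin (n - m))),
      PermGraph.Avoids π' PermGraph.perm231 ∧ PermGraph.Avoids π'' PermGraph.perm231 ∧
      (⟨n, π⟩ : PermGraph.SizedPerm) =
        PermGraph.inflation PermGraph.perm12
          ![⟨m - 1, π'⟩,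
            PermGraph.inflation PermGraph.perm21 ![PermGraph.single, ⟨n - m, π''⟩]]) ∧
    (∀ (π' : Equiv.Perm (Fin (m - 1))) (π'' : Equiv.Perm (Fin (n - m))),
      (⟨n, π⟩ : PermGraph.SizedPerm) =
        PermGraph.inflation PermGraph.perm12
          ![⟨m - 1, π'⟩,
            PermGraph.inflation PermGraph.perm21 ![PermGraph.single, ⟨n - m, π''⟩]] →
      ((PermGraph.G π).Connected ∧ (PermGraph.C π).Connected ∧ (PermGraph.B π).Connected) ∧
      ((PermGraph.G π).diam : ℤ) =
        (PermGraph.G π').diam + (PermGraph.G π'').diam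
          + ((n : ℤ) - m) * (PermGraph.length π' + PermGraph.length π'')
          + PermGraph.length π'' * ((PermGraph.length π' : ℤ) - 1) ∧
      ((PermGraph.C π).diam : ℤ) =
        (PermGraph.C π').diam + (PermGraph.C π'').diam + PermGraph.length π'' ∧
      ((PermGraph.B π).diam : ℤ) =
        (PermGraph.B π').diam + (PermGraph.B π'').diam
          + ((n : ℤ) - m) * (PermGraph.length π' + PermGraph.length π'')
          + PermGraph.length π'' * ((PermGraph.length π' : ℤ) - 2)) := by
  obtain ⟨a, rfl⟩ : ∃ a, m = a + 1 := ⟨m - 1, by omega⟩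
  have htop : PermGraph.onNat π (a + 1 - 1) = (a + 1 - 1) + (n - (a + 1)) := by
    rw [PermGraph.onNat_of_lt π (by omega)]
    omega
  simp only [← PermGraph.decomposes_iff]
  constructor
  · obtain ⟨π', π'', h⟩ := PermGraph.exists_decomposes (by omega) hπ htop
    exact ⟨π', π'', (h.avoids hπ).1, (h.avoids hπ).2, h⟩
  · intro π' π'' h
    obtain ⟨b', c', h'⟩ := PermGraph.exists_oppositeWords (h.avoids hπ).1
    obtain ⟨b'', c'', h''⟩ := PermGraph.exists_oppositeWords (h.avoids hπ).2
    obtain ⟨⟨hG, dG⟩, ⟨hC, dC⟩, ⟨hB, dB⟩⟩ :=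
      (PermGraph.OppositeWords.of_decomposes h h' h'').connected_and_diam_eq
    obtain ⟨⟨-, dG'⟩, ⟨-, dC'⟩, ⟨-, dB'⟩⟩ := h'.connected_and_diam_eq
    obtain ⟨⟨-, dG''⟩, ⟨-, dC''⟩, ⟨-, dB''⟩⟩ := h''.connected_and_diam_eq
    -- A reduced word of `π''` is needed only to pass from the truncated `r - 2` to integers.
    obtain ⟨u, -, hu, -⟩ := id h''
    have e := hu.cast_sub_two_mul_length
    have er : ((n - (a + 1) : ℕ) : ℤ) = (n : ℤ) - (a + 1 : ℕ) := Nat.cast_sub hmn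
    refine ⟨⟨hG, hC, hB⟩, ?_, ?_, ?_⟩
    · rw [dG, dG', dG'', Nat.cast_add, Nat.cast_add, Nat.cast_add, Nat.cast_add, Nat.cast_add,
        Nat.cast_add, Nat.cast_add, e, Nat.cast_mul, Nat.cast_mul, er]
      push_cast
      ring
    · rw [dC, dC', dC'']
      push_cast
      ring
    · rw [dB, dB', dB'', Nat.cast_add, Nat.cast_add, Nat.cast_add, Nat.cast_add, e, Nat.cast_mul,
        Nat.cast_mul, er]
      push_cast
      ring
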